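/- Let $\mathbb{K}=\mathbb{R}$ or $\mathbb{C}$, and let $\Lambda=(\lambda_n)_{n\ge 0}$ be a strictly increasing sequence of non-negative real numbers satisfying the Müntz condition $\sum_{n,\ \lambda_n\neq 0} 1/\lambda_n<\infty$. Let $M_\Lambda$ be the linear span of the functions $x\mapsto x^{\lambda_n}$ ($n\ge 0$) on $[0,1]$ (with $0^0=1$), let $M_\Lambda^1$ be its closure in $L^1([0,1])$ (Lebesgue measure), and let $M_\Lambda^\infty$ be its closure in $C([0,1])$ with the supremum norm, all functions being $\mathbb{K}$-valued. Then every $f\in M_\Lambda^1$ is almost everywhere equal to a function $\tilde f$ that is continuous on $[0,1)$; the value $f(0):=\tilde f(0)$ does not depend on the choice of $\tilde f$. The Cesàro operator $$\Gamma_\Lambda(f)(x)=\begin{cases} f(0) & \text{if } x=0,\\[2pt] \dfrac1x\displaystyle\int_0^x f(t)\,dt & \text{if } 0<x\le 1,\end{cases}$$ is well defined as a linear operator from $M_\Lambda^1$ to $M_\Lambda^\infty$, and it satisfies the following. 1. It is bounded and one-to-one, and its image is dense but not closed in $M_\Lambda^\infty$. 2. It is a Dunford–Pettis operator (it maps every weakly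 null sequence of $M_\Lambda^1$ to a norm null sequence of $M_\Lambda^\infty$), but it is not weakly compact (the image of the closed unit ball of $M_\Lambda^1$ is not relatively compact in the weak topology of $M_\Lambda^\infty$). -/

import Mathlib

open MeasureTheory Topology
open scoped NNReal unitInterval

noncomputable section

namespace Muntz

/-- The continuous function `x ↦ x ^ a` on `[0, 1]`, for a real exponent `a ≥ 0`
(with `0 ^ 0 = 1`). -/
def monomial (𝕜 : Type*) [RCLike 𝕜] (a : ℝ≥0) : C(I, 𝕜) where
  toFun x := (((x : ℝ) ^ (a : ℝ) : ℝ) : 𝕜)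
  continuous_toFun := RCLike.continuous_ofReal.comp
    (continuous_subtype_val.rpow_const fun _ => Or.inr a.coe_nonneg)

/-- The linear span of the monomials `x ^ (Λ n)`, `n ∈ ℕ`, in `C([0, 1])`. -/
def polySpace (𝕜 : Type*) [RCLike 𝕜] (Λ : ℕ → ℝ≥0) : Submodule 𝕜 C(I, 𝕜) :=
  Submodule.span 𝕜 (Set.range fun n => monomial 𝕜 (Λ n))

/-- The closure of the span of the monomials `x ^ (Λ n)` in `C([0, 1])` with the sup norm. -/
def MInfty (𝕜 : Type*) [RCLike 𝕜] (Λ : ℕ → ℝ≥0) : Submodule 𝕜 C(I, 𝕜) :=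
  (polySpace 𝕜 Λ).topologicalClosure

/-- The closure of the span of the monomials `x ^ (Λ n)` in `L¹([0, 1])`
(Lebesgue measure). -/
def MOne (𝕜 : Type*) [RCLike 𝕜] (Λ : ℕ → ℝ≥0) :
    Submodule 𝕜 (Lp 𝕜 1 (volume : Measure I)) :=
  ((polySpace 𝕜 Λ).map
    (ContinuousMap.toLp (E := 𝕜) 1 (volume : Measure I) 𝕜).toLinearMap).topologicalClosure

/-- Nonempty open subsets of `[0, 1]` have positive Lebesgue measure. -/
theorem isOpenPosMeasure_volume : (volume : Measure I).IsOpenPosMeasure where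
  open_pos U hU hne := by
    obtain ⟨a, b, hab, h⟩ := hU.exists_Ioo_subset hne
    intro h0
    have h1 := measure_mono_null h h0
    rw [unitInterval.volume_Ioo, ENNReal.ofReal_eq_zero] at h1
    exact absurd (sub_nonpos.mp h1) (not_le.mpr hab)

variable {𝕜 : Type*} [RCLike 𝕜]

/-- `g` is a version of `f ∈ L¹([0, 1])` that is continuous on `[0, 1)`
(its value at the point `1` is irrelevant). -/
def IsContVersion (f : Lp 𝕜 1 (volume : Measure I)) (g : I → 𝕜) : Prop :=
  ContinuousOn g (Set.Iio 1) ∧ f =ᵐ[volume] g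

/-- Any two versions that are continuous on `[0, 1)` agree on `[0, 1)`. -/
theorem IsContVersion.eqOn {f : Lp 𝕜 1 (volume : Measure I)} {g g' : I → 𝕜}
    (h : IsContVersion f g) (h' : IsContVersion f g') : Set.EqOn g g' (Set.Iio 1) :=
  haveI := isOpenPosMeasure_volume
  Measure.eqOn_open_of_ae_eq (ae_restrict_of_ae (h.2.symm.trans h'.2)) isOpen_Iio h.1 h'.1

open Classical in
/-- The value `f(0)` of a class `f ∈ L¹([0, 1])`: the value at `0` of a version of `f` that is
continuous on `[0, 1)`, if there is one (and the junk value `0` otherwise). -/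
def valueAtZero (f : Lp 𝕜 1 (volume : Measure I)) : 𝕜 :=
  if h : ∃ g : I → 𝕜, IsContVersion f g then h.choose 0 else 0

/-- `valueAtZero` does not depend on the chosen version. -/
theorem IsContVersion.valueAtZero_eq {f : Lp 𝕜 1 (volume : Measure I)} {g : I → 𝕜}
    (h : IsContVersion f g) : valueAtZero f = g 0 := by
  have hex : ∃ g : I → 𝕜, IsContVersion f g := ⟨g, h⟩
  rw [valueAtZero, dif_pos hex]
  exact hex.choose_spec.eqOn h (show (0 : I) < 1 from zero_lt_one)

open Classical in
/-- The Cesàro transform of `f`: `f(0)` at `x = 0`, and `(1 / x) ∫₀ˣ f(t) dt` for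
`0 < x ≤ 1`. -/
def cesaro (f : Lp 𝕜 1 (volume : Measure I)) (x : I) : 𝕜 :=
  if x = 0 then valueAtZero f else (x : ℝ)⁻¹ • ∫ t in Set.Iic x, f t

variable {X Y : Type*} [NormedAddCommGroup X] [NormedSpace 𝕜 X]
  [NormedAddCommGroup Y] [NormedSpace 𝕜 Y]

/-- A bounded operator is Dunford–Pettis if it maps weakly null sequences to norm null
sequences. -/
def IsDunfordPettis (T : X →L[𝕜] Y) : Prop :=
  ∀ u : ℕ → X, Filter.Tendsto (fun n => toWeakSpace 𝕜 X (u n)) Filter.atTop (𝓝 0) →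
    Filter.Tendsto (fun n => T (u n)) Filter.atTop (𝓝 0)

/-- A bounded operator is weakly compact if the image of the closed unit ball is relatively
compact for the weak topology. -/
def IsWeaklyCompact (T : X →L[𝕜] Y) : Prop :=
  IsCompact (closure (toWeakSpace 𝕜 Y '' (T '' Metric.closedBall 0 1)))

end Muntz

end

noncomputable section

namespace Muntz

open Set Filter

/-- The direction of the ray `{r (-1 + i) : r ≥ 0}` used as integration path. -/
def rayDir : ℂ := -1 + Complex.I

/-- The integrand `exp (u z) / (z + l) dz` along the ray `z = r (-1 + i)`. -/
def rayKernel (l u r : ℝ) : ℂ :=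
  Complex.exp (u * r * rayDir) * (rayDir / (r * rayDir + l))

theorem sq_norm_ray_add (l r : ℝ) : ‖(r : ℂ) * rayDir + l‖ ^ 2 = (l - r) ^ 2 + r ^ 2 := by
  rw [← Complex.normSq_eq_norm_sq, Complex.normSq_apply]
  simp [rayDir]; ring

theorem le_norm_ray_add (l r : ℝ) : r ≤ ‖(r : ℂ) * rayDir + l‖ := by
  refine le_of_sq_le_sq ?_ (norm_nonneg _)
  rw [sq_norm_ray_add]; nlinarith [sq_nonneg (l - r)]

theorem half_le_norm_ray_add (l r : ℝ) : l / 2 ≤ ‖(r : ℂ) * rayDir + l‖ := by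
  refine le_of_sq_le_sq ?_ (norm_nonneg _)
  rw [sq_norm_ray_add]; nlinarith [sq_nonneg (l - 2 * r)]

theorem ray_add_ne_zero {l : ℝ} (hl : 0 < l) (r : ℝ) : (r : ℂ) * rayDir + l ≠ 0 := by
  rw [← norm_pos_iff]
  linarith [half_le_norm_ray_add l r]

theorem norm_rayDir_le : ‖rayDir‖ ≤ 3 / 2 := by
  have : ‖rayDir‖ ^ 2 = 2 := by
    rw [← Complex.normSq_eq_norm_sq, Complex.normSq_apply]; simp [rayDir]; norm_num
  nlinarith [norm_nonneg rayDir]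

theorem norm_exp_ray (u r : ℝ) : ‖Complex.exp (u * r * rayDir)‖ = Real.exp (-u * r) := by
  rw [Complex.norm_exp]; congr 1; simp [rayDir]

theorem continuous_rayKernel {l : ℝ} (hl : 0 < l) :
    Continuous fun p : ℝ × ℝ => rayKernel l p.1 p.2 := by
  unfold rayKernel
  refine Continuous.mul (by fun_prop) (Continuous.div (by fun_prop) (by fun_prop) ?_)
  exact fun p => ray_add_ne_zero hl _

theorem norm_rayKernel_le {l : ℝ} (hl : 0 < l) (u r : ℝ) :
    ‖rayKernel l u r‖ ≤ 3 / l * Real.exp (-u * r) := by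
  rw [rayKernel, norm_mul, norm_exp_ray, mul_comm, norm_div]
  refine mul_le_mul_of_nonneg_right ?_ (Real.exp_pos _).le
  rw [div_le_div_iff₀ (norm_pos_iff.2 (ray_add_ne_zero hl r)) hl]
  nlinarith [half_le_norm_ray_add l r, norm_rayDir_le]

theorem integrableOn_rayKernel {l u : ℝ} (hl : 0 < l) (hu : 0 < u) :
    IntegrableOn (rayKernel l u) (Ioi 0) := by
  refine Integrable.mono' ((integrableOn_exp_mul_Ioi (neg_lt_zero.2 hu) 0).const_mul (3 / l))
    ?_ (.of_forall fun r => norm_rayKernel_le hl u r)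
  exact ((continuous_rayKernel hl).comp (by fun_prop : Continuous fun r : ℝ => (u, r))).aestronglyMeasurable

/-- The integral of `exp (u z) / (z + l) dz` along the ray. -/
def rayIntegral (l u : ℝ) : ℂ := ∫ r in Ioi (0 : ℝ), rayKernel l u r

theorem hasDerivAt_rayIntegral {u : ℝ} (hu : 0 < u) :
    HasDerivAt (rayIntegral 1) (-rayIntegral 1 u - 1 / u) u := by
  have key := hasDerivAt_integral_of_dominated_loc_of_deriv_le (μ := volume.restrict (Ioi (0 : ℝ)))
    (F := fun u r => rayKernel 1 u r) (F' := fun u r => (r * rayDir) * rayKernel 1 u r)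
    (x₀ := u) (s := Ioi (u / 2)) (bound := fun r => (9 / 4) * Real.exp (-(u / 2) * r))
    (Ioi_mem_nhds (by linarith))
    (.of_forall fun u => ((continuous_rayKernel one_pos).comp
      (by fun_prop : Continuous fun r : ℝ => (u, r))).aestronglyMeasurable)
    (integrableOn_rayKernel one_pos hu)
    (Continuous.aestronglyMeasurable (Continuous.mul (by fun_prop)
      ((continuous_rayKernel one_pos).comp (by fun_prop : Continuous fun r : ℝ => (u, r)))))
    ?_ ((integrableOn_exp_mul_Ioi (by linarith) 0).const_mul _) ?_
  · have h1 : (∫ r in Ioi (0 : ℝ), (r * rayDir) * rayKernel 1 u r) =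
        (∫ r in Ioi (0 : ℝ), rayDir * Complex.exp ((u * rayDir) * r)) - rayIntegral 1 u := by
      have hre : ((u : ℂ) * rayDir).re < 0 := by simp [rayDir, hu]
      rw [rayIntegral, ← integral_sub ((integrableOn_exp_mul_complex_Ioi hre 0).const_mul _)
        (integrableOn_rayKernel one_pos hu)]
      refine integral_congr_ae (.of_forall fun r => ?_)
      have := ray_add_ne_zero one_pos r
      simp only [rayKernel]
      field_simp
      push_cast
      ring
    have hre : ((u : ℂ) * rayDir).re < 0 := by simp [rayDir, hu]
    rw [integral_const_mul, integral_exp_mul_complex_Ioi hre] at h1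
    have hne : rayDir ≠ 0 := by
      intro h; simpa [rayDir] using congrArg Complex.im h
    have hu' : (u : ℂ) ≠ 0 := by exact_mod_cast hu.ne'
    refine key.2.congr_deriv ?_
    rw [h1]
    simp only [Complex.ofReal_zero, mul_zero, Complex.exp_zero]
    field_simp
    ring
  · filter_upwards [ae_restrict_mem measurableSet_Ioi] with r hr v hv
    simp only [mem_Ioi] at hr hv
    rw [rayKernel, norm_mul, norm_mul, norm_mul, norm_exp_ray, norm_div, Complex.norm_real,
      Real.norm_of_nonneg hr.le]
    have h0 := ray_add_ne_zero one_pos r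
    have h2 : Real.exp (-v * r) ≤ Real.exp (-(u / 2) * r) := by
      apply Real.exp_le_exp.2; nlinarith
    have h3 : r * (‖rayDir‖ / ‖(r : ℂ) * rayDir + (1 : ℝ)‖) ≤ ‖rayDir‖ := by
      rw [mul_div_assoc', div_le_iff₀ (norm_pos_iff.2 h0), mul_comm]
      gcongr
      exact le_norm_ray_add 1 r
    have h4 := norm_rayDir_le
    calc _ = (r * (‖rayDir‖ / ‖(r : ℂ) * rayDir + (1 : ℝ)‖)) * ‖rayDir‖ * Real.exp (-v * r) := by ring
      _ ≤ (3 / 2) * (3 / 2) * Real.exp (-(u / 2) * r) := by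
          gcongr; exact h3.trans h4
      _ = _ := by ring
  · refine .of_forall fun r v _ => ?_
    unfold rayKernel
    have : HasDerivAt (fun v : ℝ => ((v : ℂ) * r * rayDir)) (r * rayDir) v := by
      have := ((hasDerivAt_id v).ofReal_comp.mul_const ((r : ℂ) * rayDir))
      simpa [mul_assoc] using this
    refine (this.cexp.mul_const _).congr_deriv ?_
    ring

theorem exists_im_rayIntegral_one :
    ∃ C : ℝ, ∀ u : ℝ, 0 < u → (rayIntegral 1 u).im = C * Real.exp (-u) := by
  refine ⟨(rayIntegral 1 1).im * Real.exp 1, fun u hu => ?_⟩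
  have hd : ∀ v ∈ Ioi (0 : ℝ),
      HasDerivAt (fun v => (rayIntegral 1 v).im * Real.exp v) 0 v := by
    intro v hv
    have h1 : HasDerivAt (fun v => (rayIntegral 1 v).im) (-(rayIntegral 1 v).im) v := by
      have := (Complex.imCLM.hasFDerivAt.comp_hasDerivAt v (hasDerivAt_rayIntegral hv))
      have h2 : ((1 : ℂ) / (v : ℂ)).im = 0 := by
        rw [← Complex.ofReal_one, ← Complex.ofReal_div, Complex.ofReal_im]
      refine this.congr_deriv ?_
      rw [Complex.imCLM_apply, Complex.sub_im, h2, Complex.neg_im, sub_zero]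
    refine (h1.mul (Real.hasDerivAt_exp v)).congr_deriv ?_
    ring
  have := (convex_Ioi (0 : ℝ)).is_const_of_fderivWithin_eq_zero (𝕜 := ℝ)
    (f := fun v => (rayIntegral 1 v).im * Real.exp v)
    (fun v hv => (hd v hv).differentiableAt.differentiableWithinAt)
    (fun v hv => by
      rw [fderivWithin_of_isOpen isOpen_Ioi hv]
      have := (hd v hv).hasFDerivAt.fderiv
      rw [this]; ext; simp) (mem_Ioi.2 hu) (mem_Ioi.2 one_pos)
  rw [← this, mul_assoc, ← Real.exp_add]
  simp

theorem integrable_exp_mul_rayKernel :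
    Integrable (fun p : ℝ × ℝ => Complex.exp (-p.1) * rayKernel 1 p.1 p.2)
      ((volume.restrict (Ioi 0)).prod (volume.restrict (Ioi 0))) := by
  have hn : ∀ u r : ℝ, ‖Complex.exp (-u) * rayKernel 1 u r‖ =
      ‖rayDir / (r * rayDir + (1 : ℝ))‖ * Real.exp (-(1 + r) * u) := by
    intro u r
    rw [rayKernel, norm_mul, norm_mul, norm_exp_ray, Complex.norm_exp, ← mul_assoc, ← Real.exp_add,
      mul_comm]
    congr 2
    simp; ring
  have hc : Continuous fun p : ℝ × ℝ => Complex.exp (-p.1) * rayKernel 1 p.1 p.2 :=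
    Continuous.mul (by fun_prop) (continuous_rayKernel one_pos)
  rw [integrable_prod_iff' hc.aestronglyMeasurable]
  constructor
  · filter_upwards [ae_restrict_mem measurableSet_Ioi] with r hr
    have hr' : -(1 + r) < 0 := by simp only [mem_Ioi] at hr; linarith
    refine Integrable.mono' ((integrableOn_exp_mul_Ioi hr' 0).const_mul
      ‖rayDir / (r * rayDir + (1 : ℝ))‖) ?_ (.of_forall fun u => (hn u r).le)
    exact (hc.comp (by fun_prop : Continuous fun u : ℝ => (u, r))).aestronglyMeasurable
  · refine Integrable.mono' ((integrable_inv_one_add_sq.const_mul (9 / 2)).restrict (s := Ioi 0)) ?_ ?_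
    · exact (hc.norm.comp continuous_swap).aestronglyMeasurable.integral_prod_right'
    · filter_upwards [ae_restrict_mem measurableSet_Ioi] with r hr
      simp only [mem_Ioi] at hr
      have hr' : -(1 + r) < 0 := by linarith
      simp_rw [hn]
      rw [integral_const_mul, integral_exp_mul_Ioi hr', norm_div]
      have h0 := norm_pos_iff.2 (ray_add_ne_zero one_pos r)
      have h1 := le_norm_ray_add 1 r
      have h2 := half_le_norm_ray_add 1 r
      have h3 := norm_rayDir_le
      set N := ‖(r : ℂ) * rayDir + (1 : ℝ)‖
      have h4 : ‖rayDir‖ / N ≤ (9 / 2) / (1 + r) := by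
        rw [div_le_div_iff₀ h0 (by linarith)]
        nlinarith [norm_nonneg rayDir]
      have h5 : -Real.exp (-(1 + r) * 0) / -(1 + r) = 1 / (1 + r) := by
        rw [mul_zero, Real.exp_zero, neg_div_neg_eq]
      rw [h5, Real.norm_of_nonneg (by positivity)]
      calc ‖rayDir‖ / N * (1 / (1 + r)) ≤ (9 / 2) / (1 + r) * (1 / (1 + r)) := by gcongr
        _ = (9 / 2) * ((1 + r) ^ 2)⁻¹ := by field_simp
        _ ≤ _ := by gcongr; nlinarith

theorem integral_exp_mul_rayKernel {r : ℝ} (hr : 0 < r) :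
    ∫ u in Ioi (0 : ℝ), Complex.exp (-u) * rayKernel 1 u r =
      rayDir / (1 + 2 * Complex.I * r ^ 2) := by
  have hre : ((r : ℂ) * rayDir - 1).re < 0 := by simp [rayDir]; linarith
  have h0 := ray_add_ne_zero one_pos r
  have h1 : (r : ℂ) * rayDir - 1 ≠ 0 := fun h => by rw [h] at hre; simp at hre
  have h2 : rayDir ^ 2 = -2 * Complex.I := by
    rw [rayDir]; ring_nf; rw [Complex.I_sq]; ring
  have h3 : (1 + 2 * Complex.I * (r : ℂ) ^ 2) = -(r * rayDir + (1 : ℝ)) * (r * rayDir - 1) := by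
    push_cast
    linear_combination ((r : ℂ) ^ 2) * h2
  calc _ = ∫ u in Ioi (0 : ℝ), rayDir / (r * rayDir + (1 : ℝ)) *
        Complex.exp ((r * rayDir - 1) * u) := by
        refine integral_congr_ae (.of_forall fun u => ?_)
        simp only [rayKernel]
        rw [← mul_assoc, ← Complex.exp_add, mul_comm]
        congr 2; ring
    _ = _ := by
        rw [integral_const_mul, integral_exp_mul_complex_Ioi hre, h3]
        simp only [Complex.ofReal_zero, mul_zero, Complex.exp_zero]
        field_simp

theorem exists_im_rayIntegral_one_ne_zero :
    ∃ C : ℝ, C ≠ 0 ∧ ∀ u : ℝ, 0 < u → (rayIntegral 1 u).im = C * Real.exp (-u) := by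
  obtain ⟨C, hC⟩ := exists_im_rayIntegral_one
  refine ⟨C, ?_, hC⟩
  rintro rfl
  have hsw := integral_integral_swap (f := fun u r : ℝ => Complex.exp (-u) * rayKernel 1 u r)
    integrable_exp_mul_rayKernel
  have hint : Integrable (fun r : ℝ => rayDir / (1 + 2 * Complex.I * (r : ℂ) ^ 2))
      (volume.restrict (Ioi 0)) := by
    refine integrable_exp_mul_rayKernel.integral_prod_right.congr ?_
    filter_upwards [ae_restrict_mem measurableSet_Ioi] with r hr
    exact integral_exp_mul_rayKernel hr
  have hint' := integrable_exp_mul_rayKernel.integral_prod_left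
  have hL : (∫ u in Ioi (0 : ℝ), ∫ r in Ioi (0 : ℝ), Complex.exp (-u) * rayKernel 1 u r).im = 0 := by
    rw [← Complex.imCLM_apply, ← Complex.imCLM.integral_comp_comm hint']
    refine integral_eq_zero_of_ae ?_
    filter_upwards [ae_restrict_mem measurableSet_Ioi] with u hu
    rw [integral_const_mul]
    have := hC u hu
    rw [rayIntegral, zero_mul] at this
    have h2 : Complex.exp (-(u : ℂ)) = ((Real.exp (-u) : ℝ) : ℂ) := by push_cast; rfl
    rw [h2, Complex.imCLM_apply, Complex.im_ofReal_mul, this, mul_zero]; rfl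
  rw [hsw, setIntegral_congr_fun measurableSet_Ioi (fun r hr => integral_exp_mul_rayKernel hr),
    ← Complex.imCLM_apply, ← Complex.imCLM.integral_comp_comm hint] at hL
  have hval : ∀ r : ℝ, Complex.imCLM (rayDir / (1 + 2 * Complex.I * (r : ℂ) ^ 2)) =
      (1 + 2 * r ^ 2) / (1 + 4 * r ^ 4) := by
    intro r
    have h1 : (1 + 2 * Complex.I * (r : ℂ) ^ 2) = ((1 : ℝ) : ℂ) + ((2 * r ^ 2 : ℝ) : ℂ) * Complex.I := by
      push_cast; ring
    have h2 : Complex.normSq (((1 : ℝ) : ℂ) + ((2 * r ^ 2 : ℝ) : ℂ) * Complex.I) = 1 + 4 * r ^ 4 := by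
      rw [Complex.normSq_add_mul_I]; ring
    rw [h1, Complex.imCLM_apply, Complex.div_im, h2]
    simp only [rayDir, Complex.add_re, Complex.add_im, Complex.mul_re, Complex.mul_im,
      Complex.ofReal_re, Complex.ofReal_im, Complex.I_re, Complex.I_im, Complex.neg_re,
      Complex.neg_im, Complex.one_re, Complex.one_im]
    ring
  simp_rw [hval] at hL
  have hint2 : Integrable (fun r : ℝ => (1 + 2 * r ^ 2) / (1 + 4 * r ^ 4))
      (volume.restrict (Ioi 0)) :=
    (Complex.imCLM.integrable_comp hint).congr (.of_forall hval)
  rw [integral_eq_zero_iff_of_nonneg (fun r => by positivity) hint2] at hL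
  have : ∀ᵐ r ∂(volume.restrict (Ioi (0 : ℝ))), False := by
    filter_upwards [hL] with r hr
    have : 0 < (1 + 2 * r ^ 2) / (1 + 4 * r ^ 4) := by positivity
    exact this.ne' hr
  rw [eventually_false_iff_eq_bot, ae_eq_bot, Measure.restrict_eq_zero] at this
  simp at this

/-- Up to a nonzero constant, `exp (-l s)` is the integral of `exp (s z) / (z + l)` over the
contour formed by the ray through `-1 + i` and its complex conjugate. -/
theorem exists_im_rayIntegral :
    ∃ C : ℝ, C ≠ 0 ∧ ∀ l s : ℝ, 0 < l → 0 < s → (rayIntegral l s).im = C * Real.exp (-l * s) := by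
  obtain ⟨C, hC0, hC⟩ := exists_im_rayIntegral_one_ne_zero
  refine ⟨C, hC0, fun l s hl hs => ?_⟩
  have := integral_comp_mul_left_Ioi (fun r => rayKernel l s r) 0 hl
  have h2 : rayIntegral l s = rayIntegral 1 (l * s) := by
    rw [mul_zero] at this
    have hk : ∀ r : ℝ, rayKernel l s (l * r) = l⁻¹ • rayKernel 1 (l * s) r := by
      intro r
      have h0 := ray_add_ne_zero one_pos r
      have hl' : (l : ℂ) ≠ 0 := by exact_mod_cast hl.ne'
      have h1 : ((l * r : ℝ) : ℂ) * rayDir + l = l * (r * rayDir + (1 : ℝ)) := by push_cast; ring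
      rw [rayKernel, rayKernel, h1, Complex.real_smul]
      have h3 : (s : ℂ) * ((l * r : ℝ) : ℂ) * rayDir = ((l * s : ℝ) : ℂ) * r * rayDir := by
        push_cast; ring
      rw [h3]
      push_cast at h0 ⊢
      field_simp
    simp_rw [hk] at this
    rw [integral_smul] at this
    exact (smul_right_injective ℂ (inv_ne_zero hl.ne') this).symm
  rw [h2, hC _ (mul_pos hl hs), neg_mul]

/-- The partial fraction `∑ aₙ / (mₙ - z)` times the Blaschke product `∏ (mₙ - z) / (mₙ + z)`. -/
def blaschkeFraction (a m : ℕ → ℝ) (S : Finset ℕ) (z : ℂ) : ℂ :=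
  ∑ n ∈ S, a n / (m n + z) * ∏ k ∈ S.erase n, ((m k - z) / (m k + z))

section HalfPlane

variable {a m : ℕ → ℝ} {S : Finset ℕ} {z : ℂ}

theorem le_norm_ofReal_add {x : ℝ} (hz : 0 ≤ z.re) : x ≤ ‖(x : ℂ) + z‖ := by
  refine le_trans ?_ (Complex.re_le_norm _)
  simpa using hz

theorem ofReal_add_ne_zero {x : ℝ} (hx : 0 < x) (hz : 0 ≤ z.re) : (x : ℂ) + z ≠ 0 :=
  norm_pos_iff.1 (hx.trans_le (le_norm_ofReal_add hz))

theorem norm_blaschkeFactor_le_one {x : ℝ} (hx : 0 < x) (hz : 0 ≤ z.re) :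
    ‖((x : ℂ) - z) / (x + z)‖ ≤ 1 := by
  rw [norm_div, div_le_one (norm_pos_iff.2 (ofReal_add_ne_zero hx hz))]
  refine le_of_sq_le_sq ?_ (norm_nonneg _)
  rw [← Complex.normSq_eq_norm_sq, ← Complex.normSq_eq_norm_sq, Complex.normSq_apply,
    Complex.normSq_apply]
  simp
  nlinarith

theorem blaschkeFraction_eq (hm : ∀ n, 0 < m n) (hz : 0 ≤ z.re) (hzm : ∀ n ∈ S, (m n : ℂ) ≠ z) :
    blaschkeFraction a m S z =
      (∑ n ∈ S, a n / (m n - z)) * ∏ n ∈ S, ((m n - z) / (m n + z)) := by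
  rw [blaschkeFraction, Finset.sum_mul]
  refine Finset.sum_congr rfl fun n hn => ?_
  rw [← Finset.mul_prod_erase S _ hn, ← mul_assoc]
  congr 1
  have h1 := ofReal_add_ne_zero (hm n) hz
  have h2 := sub_ne_zero.2 (hzm n hn)
  field_simp

theorem norm_blaschkeFraction_le (hm : ∀ n, 0 < m n) {M : ℝ}
    (hM : ∀ y : ℝ, ‖∑ n ∈ S, (a n : ℂ) / (m n - y * Complex.I)‖ ≤ M) (hz : 0 ≤ z.re) :
    ‖blaschkeFraction a m S z‖ ≤ M := by
  have hb : ∀ w : ℂ, 0 ≤ w.re → ‖blaschkeFraction a m S w‖ ≤ ∑ n ∈ S, |a n| / m n := by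
    intro w hw
    refine (norm_sum_le _ _).trans (Finset.sum_le_sum fun n _ => ?_)
    rw [norm_mul, norm_div, norm_prod, Complex.norm_real, Real.norm_eq_abs]
    calc _ ≤ |a n| / m n * 1 := by
          have := hm n
          gcongr
          · exact le_norm_ofReal_add hw
          · exact Finset.prod_le_one (fun _ _ => norm_nonneg _)
              fun k _ => norm_blaschkeFactor_le_one (hm k) hw
      _ = _ := mul_one _
  have hd : ∀ w : ℂ, 0 ≤ w.re → DifferentiableAt ℂ (blaschkeFraction a m S) w := by
    intro w hw
    unfold blaschkeFraction
    refine DifferentiableAt.fun_sum fun n _ => DifferentiableAt.mul ?_ ?_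
    · exact DifferentiableAt.div (by fun_prop) (by fun_prop) (ofReal_add_ne_zero (hm n) hw)
    · refine DifferentiableAt.fun_finsetProd fun k _ => ?_
      exact DifferentiableAt.div (by fun_prop) (by fun_prop) (ofReal_add_ne_zero (hm k) hw)
  refine PhragmenLindelof.right_half_plane_of_bounded_on_real ?_ ?_ ?_ ?_ hz
  · refine ⟨fun w hw => (hd w (le_of_lt hw)).differentiableWithinAt, fun w hw => ?_⟩
    rw [Complex.closure_setOfPred_lt_re] at hw
    exact (hd w hw).continuousAt.continuousWithinAt
  · refine ⟨1, one_lt_two, 0, ?_⟩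
    refine Asymptotics.IsBigO.of_bound (∑ n ∈ S, |a n| / m n) ?_
    refine eventually_inf_principal.2 (.of_forall fun w hw => ?_)
    simpa using hb w (le_of_lt hw)
  · refine ⟨∑ n ∈ S, |a n| / m n, ?_⟩
    rw [eventually_map]
    filter_upwards [eventually_ge_atTop 0] with x hx using hb x (by simpa using hx)
  · intro y
    have hy : (0 : ℝ) ≤ ((y : ℂ) * Complex.I).re := by simp
    rw [blaschkeFraction_eq hm hy, norm_mul]
    · calc _ ≤ M * 1 := by
            refine mul_le_mul (hM y) ?_ (norm_nonneg _) ((norm_nonneg _).trans (hM y))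
            rw [norm_prod]
            exact Finset.prod_le_one (fun _ _ => norm_nonneg _)
              fun k _ => norm_blaschkeFactor_le_one (hm k) hy
        _ = M := mul_one _
    · intro n _ h
      have := congrArg Complex.re h
      simp at this
      exact (hm n).ne' this

theorem norm_sum_div_sub_le (hm : ∀ n, 0 < m n) {M : ℝ}
    (hM : ∀ y : ℝ, ‖∑ n ∈ S, (a n : ℂ) / (m n - y * Complex.I)‖ ≤ M) (hz : 0 ≤ z.re)
    (hzm : ∀ n ∈ S, (m n : ℂ) ≠ z) :
    ‖∑ n ∈ S, (a n : ℂ) / (m n - z)‖ ≤ M * ∏ n ∈ S, (‖(m n : ℂ) + z‖ / ‖(m n : ℂ) - z‖) := by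
  have h := norm_blaschkeFraction_le hm hM hz
  rw [blaschkeFraction_eq hm hz hzm, norm_mul] at h
  have hpos : ∀ n ∈ S, 0 < ‖(m n : ℂ) - z‖ / ‖(m n : ℂ) + z‖ := fun n hn =>
    div_pos (norm_pos_iff.2 (sub_ne_zero.2 (hzm n hn)))
      (norm_pos_iff.2 (ofReal_add_ne_zero (hm n) hz))
  have h1 : ∏ n ∈ S, (‖(m n : ℂ) + z‖ / ‖(m n : ℂ) - z‖) =
      (∏ n ∈ S, (‖(m n : ℂ) - z‖ / ‖(m n : ℂ) + z‖))⁻¹ := by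
    rw [← Finset.prod_inv_distrib]
    exact Finset.prod_congr rfl fun n _ => (inv_div _ _).symm
  rw [norm_prod] at h
  simp_rw [norm_div] at h
  rw [h1, ← div_eq_mul_inv, le_div_iff₀ (Finset.prod_pos hpos)]
  simpa using h

end HalfPlane

/-- The Mellin transform of a Müntz polynomial is bounded by its `L¹` norm. -/
theorem norm_sum_div_le_integral {l : ℕ → ℝ} (hl : ∀ n, 0 ≤ l n) (a : ℕ → ℝ) (S : Finset ℕ) (y : ℝ) :
    ‖∑ n ∈ S, (a n : ℂ) / (((l n + 1 : ℝ) : ℂ) - y * Complex.I)‖ ≤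
      ∫ x in (0 : ℝ)..1, |∑ n ∈ S, a n * x ^ l n| := by
  have hre : ∀ n, -1 < ((l n : ℂ) - y * Complex.I).re := fun n => by
    simp; linarith [hl n]
  have h1 : ∑ n ∈ S, (a n : ℂ) / (((l n + 1 : ℝ) : ℂ) - y * Complex.I) =
      ∫ x in (0 : ℝ)..1, ∑ n ∈ S, (a n : ℂ) * (x : ℂ) ^ ((l n : ℂ) - y * Complex.I) := by
    rw [intervalIntegral.integral_finsetSum]
    · refine Finset.sum_congr rfl fun n _ => ?_
      have hne : (l n : ℂ) - y * Complex.I + 1 ≠ 0 := fun h => by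
        have h2 := congrArg Complex.re h
        have h3 := hl n
        simp at h2
        linarith
      rw [intervalIntegral.integral_const_mul, integral_cpow (Or.inl (hre n)), Complex.ofReal_one,
        Complex.one_cpow, Complex.ofReal_zero, Complex.zero_cpow hne]
      push_cast
      rw [sub_zero, mul_one_div]
      congr 1; ring
    · exact fun n _ => (intervalIntegral.intervalIntegrable_cpow' (hre n)).const_mul _
  rw [h1]
  refine (intervalIntegral.norm_integral_le_integral_norm zero_le_one).trans (le_of_eq ?_)
  refine intervalIntegral.integral_congr_ae (.of_forall fun x hx => ?_)
  rw [uIoc_of_le zero_le_one] at hx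
  have hx' : (x : ℂ) ≠ 0 := by exact_mod_cast hx.1.ne'
  have h2 : ∑ n ∈ S, (a n : ℂ) * (x : ℂ) ^ ((l n : ℂ) - y * Complex.I) =
      ((∑ n ∈ S, a n * x ^ l n : ℝ) : ℂ) * (x : ℂ) ^ (-(y * Complex.I)) := by
    push_cast
    rw [Finset.sum_mul]
    refine Finset.sum_congr rfl fun n _ => ?_
    rw [sub_eq_add_neg, Complex.cpow_add _ _ hx', Complex.ofReal_cpow hx.1.le, mul_assoc]
  rw [h2, norm_mul, Complex.norm_cpow_eq_rpow_re_of_pos hx.1, Complex.norm_real, Real.norm_eq_abs]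
  simp

theorem exists_prod_ray_le {l : ℕ → ℝ} (hl : ∀ n, 0 < l n) (hs : Summable fun n => 1 / l n)
    {δ : ℝ} (hδ : 0 < δ) : ∃ D : ℝ, 0 ≤ D ∧ ∀ (S : Finset ℕ) (r : ℝ), 0 < r →
      ∏ n ∈ S, (‖((l n + 1 : ℝ) : ℂ) + (1 - r * rayDir)‖ / ‖((l n + 1 : ℝ) : ℂ) - (1 - r * rayDir)‖)
        ≤ D * Real.exp (δ * r) := by
  obtain ⟨T, hT⟩ := summable_iff_vanishing_norm.1 hs (δ / 6) (by positivity)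
  refine ⟨Real.exp ((∑ n ∈ T, (4 + 4 / l n)) + 4 * (δ / 6)), (Real.exp_pos _).le, fun S r hr => ?_⟩
  have hf : ∀ n, ‖((l n + 1 : ℝ) : ℂ) + (1 - r * rayDir)‖ / ‖((l n + 1 : ℝ) : ℂ) - (1 - r * rayDir)‖
      ≤ Real.exp ((if n ∈ T then 4 + 4 / l n else 0) + (4 + 6 * r) * (if n ∈ T then 0 else 1 / l n)) := by
    intro n
    have e1 : ((l n + 1 : ℝ) : ℂ) - (1 - r * rayDir) = r * rayDir + l n := by push_cast; ring
    have e2 : ((l n + 1 : ℝ) : ℂ) + (1 - r * rayDir) = (r * rayDir + l n) + 2 * (1 - r * rayDir) := by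
      push_cast; ring
    have h1 := le_norm_ray_add (l n) r
    have h2 := half_le_norm_ray_add (l n) r
    have h0 := norm_pos_iff.2 (ray_add_ne_zero (hl n) r)
    have h3 : ‖(2 : ℂ) * (1 - r * rayDir)‖ ≤ 2 + 3 * r := by
      rw [norm_mul]
      have : ‖(1 : ℂ) - r * rayDir‖ ≤ 1 + r * (3 / 2) := by
        refine (norm_sub_le _ _).trans ?_
        rw [norm_mul, Complex.norm_real, Real.norm_of_nonneg hr.le, norm_one]
        gcongr; exact norm_rayDir_le
      have h5 : ‖(2 : ℂ)‖ = 2 := by simp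
      rw [h5]; linarith
    have h4 : ‖(r * rayDir + l n) + 2 * (1 - r * rayDir)‖ / ‖(r : ℂ) * rayDir + l n‖ ≤
        1 + (2 + 3 * r) / ‖(r : ℂ) * rayDir + l n‖ := by
      rw [div_le_iff₀ h0, add_mul, div_mul_cancel₀ _ h0.ne', one_mul]
      exact (norm_add_le _ _).trans (by gcongr)
    have hln := hl n
    rw [e1, e2]
    refine h4.trans ?_
    set N := ‖(r : ℂ) * rayDir + l n‖
    split_ifs
    · refine le_trans ?_ (Real.add_one_le_exp _)
      have h6 : 2 / N ≤ 4 / l n := by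
        rw [div_le_div_iff₀ h0 hln]; linarith
      have h7 : 3 * r / N ≤ 3 := by
        rw [div_le_iff₀ h0]; linarith
      rw [add_div]; linarith
    · refine le_trans ?_ (Real.add_one_le_exp _)
      have h6 : (2 + 3 * r) / N ≤ (4 + 6 * r) * (1 / l n) := by
        rw [mul_one_div, div_le_div_iff₀ h0 hln]; nlinarith
      linarith
  calc _ ≤ ∏ n ∈ S, Real.exp ((if n ∈ T then 4 + 4 / l n else 0) +
        (4 + 6 * r) * (if n ∈ T then 0 else 1 / l n)) :=
        Finset.prod_le_prod (fun _ _ => by positivity) fun n _ => hf n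
    _ = Real.exp (∑ n ∈ S, (if n ∈ T then 4 + 4 / l n else 0) +
        (4 + 6 * r) * ∑ n ∈ S, (if n ∈ T then 0 else 1 / l n)) := by
        rw [← Real.exp_sum, Finset.sum_add_distrib, Finset.mul_sum]
    _ ≤ Real.exp ((∑ n ∈ T, (4 + 4 / l n)) + (4 + 6 * r) * (δ / 6)) := by
        have hp : ∀ n, 0 ≤ 4 + 4 / l n := fun n => by have := hl n; positivity
        gcongr
        · rw [Finset.sum_ite_mem]
          exact Finset.sum_le_sum_of_subset_of_nonneg Finset.inter_subset_right fun n _ _ => hp n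
        · have h8 : ∑ n ∈ S, (if n ∈ T then 0 else 1 / l n) = ∑ n ∈ S \ T, 1 / l n := by
            rw [Finset.sdiff_eq_filter, Finset.sum_filter]
            exact Finset.sum_congr rfl fun n _ => by split_ifs <;> simp_all
          rw [h8]
          exact (le_abs_self _).trans (hT _ Finset.sdiff_disjoint).le
    _ = _ := by rw [← Real.exp_add]; congr 1; ring

/-- A bounded Remez-type inequality for Müntz polynomials with positive exponents. -/
theorem exists_abs_sum_exp_le {l : ℕ → ℝ} (hl : ∀ n, 0 < l n) (hs : Summable fun n => 1 / l n)
    {s₀ : ℝ} (hs₀ : 0 < s₀) : ∃ D : ℝ, 0 ≤ D ∧ ∀ (S : Finset ℕ) (a : ℕ → ℝ) (s : ℝ), s₀ ≤ s →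
      |∑ n ∈ S, a n * Real.exp (-l n * s)| ≤ D * ∫ x in (0 : ℝ)..1, |∑ n ∈ S, a n * x ^ l n| := by
  obtain ⟨C, hC0, hC⟩ := exists_im_rayIntegral
  obtain ⟨D, hD0, hD⟩ := exists_prod_ray_le hl hs (half_pos hs₀)
  refine ⟨|C|⁻¹ * (3 / 2 * D * (2 / s₀)), by positivity, fun S a s hs => ?_⟩
  set M := ∫ x in (0 : ℝ)..1, |∑ n ∈ S, a n * x ^ l n| with hM
  have hsp : 0 < s := hs₀.trans_le hs
  have hM0 : 0 ≤ M := intervalIntegral.integral_nonneg zero_le_one fun _ _ => abs_nonneg _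
  have h1 : C * ∑ n ∈ S, a n * Real.exp (-l n * s) =
      (∫ r in Ioi (0 : ℝ), ∑ n ∈ S, (a n : ℂ) * rayKernel (l n) s r).im := by
    rw [integral_finsetSum _ fun n _ => (integrableOn_rayKernel (hl n) hsp).const_mul _,
      Complex.im_sum, Finset.mul_sum]
    refine Finset.sum_congr rfl fun n _ => ?_
    rw [integral_const_mul, Complex.im_ofReal_mul]
    have := hC (l n) s (hl n) hsp
    rw [rayIntegral] at this
    rw [this]; ring
  have h2 : ∀ r ∈ Ioi (0 : ℝ), ‖∑ n ∈ S, (a n : ℂ) * rayKernel (l n) s r‖ ≤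
      3 / 2 * D * M * Real.exp (-(s₀ / 2) * r) := by
    intro r hr
    have hr' : 0 < r := hr
    have hz : (0 : ℝ) ≤ ((1 : ℂ) - r * rayDir).re := by simp [rayDir]; linarith
    have e1 : ∀ n, ((l n + 1 : ℝ) : ℂ) - (1 - r * rayDir) = r * rayDir + l n := fun n => by
      push_cast; ring
    have h3 := norm_sum_div_sub_le (a := a) (m := fun n => l n + 1) (S := S)
      (fun n => by have := hl n; positivity)
      (fun y => norm_sum_div_le_integral (fun n => (hl n).le) a S y) hz
      (fun n _ h => ray_add_ne_zero (hl n) r (by rw [← e1 n, h, sub_self]))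
    have h4 : ∑ n ∈ S, (a n : ℂ) * rayKernel (l n) s r = Complex.exp (s * r * rayDir) * rayDir *
        ∑ n ∈ S, (a n : ℂ) / (((l n + 1 : ℝ) : ℂ) - (1 - r * rayDir)) := by
      rw [Finset.mul_sum]
      refine Finset.sum_congr rfl fun n _ => ?_
      rw [e1, rayKernel]; ring
    rw [h4, norm_mul, norm_mul, norm_exp_ray]
    calc _ ≤ Real.exp (-s * r) * (3 / 2) * (M * (D * Real.exp (s₀ / 2 * r))) := by
          gcongr
          · exact norm_rayDir_le
          · exact h3.trans (mul_le_mul_of_nonneg_left (hD S r hr') hM0)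
      _ = 3 / 2 * D * M * Real.exp (-s * r + s₀ / 2 * r) := by rw [Real.exp_add]; ring
      _ ≤ _ := by gcongr; nlinarith
  have h5 : |C * ∑ n ∈ S, a n * Real.exp (-l n * s)| ≤ 3 / 2 * D * M * (2 / s₀) := by
    rw [h1]
    refine (Complex.abs_im_le_norm _).trans ?_
    have hint : IntegrableOn (fun r => 3 / 2 * D * M * Real.exp (-(s₀ / 2) * r)) (Ioi 0) :=
      (integrableOn_exp_mul_Ioi (by linarith) 0).const_mul _
    refine (norm_integral_le_of_norm_le hint ?_).trans (le_of_eq ?_)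
    · filter_upwards [ae_restrict_mem measurableSet_Ioi] with r hr using h2 r hr
    · rw [integral_const_mul, integral_exp_mul_Ioi (by linarith)]
      simp
  rw [abs_mul] at h5
  have hCp : 0 < |C| := abs_pos.2 hC0
  rw [mul_assoc, inv_mul_eq_div, le_div_iff₀ hCp, mul_comm]
  linarith

/-- The constant coefficient of a Müntz polynomial is controlled by its `L¹` norm. -/
theorem exists_abs_coeff_zero_le {l : ℕ → ℝ} (hl0 : l 0 = 0) (hl : ∀ n, n ≠ 0 → 0 < l n)
    (hs : Summable fun n => 1 / l n) :
    ∃ D : ℝ, 0 ≤ D ∧ ∀ (S : Finset ℕ) (a : ℕ → ℝ), 0 ∈ S →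
      |a 0| ≤ D * ∫ x in (0 : ℝ)..1, |∑ n ∈ S, a n * x ^ l n| := by
  refine ⟨2 * Real.exp (2 * ∑' n, 1 / l n), by positivity, fun S a h0 => ?_⟩
  set M := ∫ x in (0 : ℝ)..1, |∑ n ∈ S, a n * x ^ l n| with hM
  have hl' : ∀ n, 0 ≤ l n := fun n => by
    rcases eq_or_ne n 0 with rfl | h
    · exact hl0.ge
    · exact (hl n h).le
  have hM0 : 0 ≤ M := intervalIntegral.integral_nonneg zero_le_one fun _ _ => abs_nonneg _
  have h1 := norm_blaschkeFraction_le (a := a) (m := fun n => l n + 1) (S := S) (z := 1)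
    (fun n => by have := hl' n; positivity)
    (fun y => norm_sum_div_le_integral hl' a S y) (by simp)
  have h2 : blaschkeFraction a (fun n => l n + 1) S 1 =
      ((a 0 / 2 * ∏ k ∈ S.erase 0, (l k / (l k + 2)) : ℝ) : ℂ) := by
    rw [blaschkeFraction, Finset.sum_eq_single_of_mem 0 h0]
    · push_cast
      rw [hl0]
      congr 1
      · norm_num
      · refine Finset.prod_congr rfl fun k _ => ?_
        congr 1
        · ring
        · ring
    · intro n _ hn0
      refine mul_eq_zero_of_right _ (Finset.prod_eq_zero (Finset.mem_erase.2 ⟨hn0.symm, h0⟩) ?_)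
      simp [hl0]
  rw [h2, Complex.norm_real, norm_mul, Real.norm_eq_abs, Real.norm_eq_abs, abs_div, abs_two] at h1
  have hpos : ∀ k ∈ S.erase 0, 0 < l k / (l k + 2) := fun k hk => by
    have := hl k (Finset.ne_of_mem_erase hk); positivity
  have h3 : (∏ k ∈ S.erase 0, (l k / (l k + 2)))⁻¹ ≤ Real.exp (2 * ∑' n, 1 / l n) := by
    rw [← Finset.prod_inv_distrib]
    calc _ ≤ ∏ k ∈ S.erase 0, Real.exp (2 * (1 / l k)) := by
          refine Finset.prod_le_prod (fun k hk => (inv_pos.2 (hpos k hk)).le) fun k hk => ?_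
          refine le_trans (le_of_eq ?_) (Real.add_one_le_exp _)
          have := hl k (Finset.ne_of_mem_erase hk)
          field_simp
          ring
      _ = Real.exp (2 * ∑ k ∈ S.erase 0, 1 / l k) := by
          rw [← Real.exp_sum, Finset.mul_sum]
      _ ≤ _ := by
          gcongr
          exact hs.sum_le_tsum _ fun n _ => one_div_nonneg.2 (hl' n)
  have hP := Finset.prod_pos hpos
  rw [abs_of_pos hP, ← le_div_iff₀ hP, div_eq_mul_inv] at h1
  have := h1.trans (mul_le_mul_of_nonneg_left h3 hM0)
  linarith

theorem exists_abs_sum_rpow_le_of_pos {l : ℕ → ℝ} (hl : ∀ n, 0 < l n)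
    (hs : Summable fun n => 1 / l n) {b : ℝ} (hb : b < 1) :
    ∃ D : ℝ, 0 ≤ D ∧ ∀ (S : Finset ℕ) (a : ℕ → ℝ) (x : ℝ), 0 ≤ x → x ≤ b →
      |∑ n ∈ S, a n * x ^ l n| ≤ D * ∫ x in (0 : ℝ)..1, |∑ n ∈ S, a n * x ^ l n| := by
  have hb1 : max b (1 / 2) < 1 := max_lt hb (by norm_num)
  have hb0 : 0 < max b (1 / 2) := lt_max_of_lt_right (by norm_num)
  obtain ⟨D, hD0, hD⟩ := exists_abs_sum_exp_le hl hs (neg_pos.2 (Real.log_neg hb0 hb1))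
  refine ⟨D, hD0, fun S a x hx0 hxb => ?_⟩
  rcases hx0.eq_or_lt with rfl | hx
  · have : ∑ n ∈ S, a n * (0 : ℝ) ^ l n = 0 :=
      Finset.sum_eq_zero fun n _ => by rw [Real.zero_rpow (hl n).ne', mul_zero]
    rw [this, abs_zero]
    exact mul_nonneg hD0 (intervalIntegral.integral_nonneg zero_le_one fun _ _ => abs_nonneg _)
  · have h := hD S a (-Real.log x)
      (neg_le_neg (Real.log_le_log hx (hxb.trans (le_max_left _ _))))
    convert h using 4 with n
    rw [Real.rpow_def_of_pos hx, neg_mul_neg, mul_comm]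

theorem exists_abs_sum_rpow_le {l : ℕ → ℝ} (hl0 : 0 ≤ l 0) (hl : ∀ n, n ≠ 0 → 0 < l n)
    (hs : Summable fun n => 1 / l n) {b : ℝ} (hb : b < 1) :
    ∃ D : ℝ, 0 ≤ D ∧ ∀ (S : Finset ℕ) (a : ℕ → ℝ) (x : ℝ), 0 ≤ x → x ≤ b →
      |∑ n ∈ S, a n * x ^ l n| ≤ D * ∫ x in (0 : ℝ)..1, |∑ n ∈ S, a n * x ^ l n| := by
  rcases hl0.eq_or_lt with h0 | h0
  swap
  · refine exists_abs_sum_rpow_le_of_pos (fun n => ?_) hs hb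
    rcases eq_or_ne n 0 with rfl | h
    exacts [h0, hl n h]
  obtain ⟨D₀, hD₀, hc⟩ := exists_abs_coeff_zero_le h0.symm hl hs
  set l' : ℕ → ℝ := Function.update l 0 1 with hl'
  have hne : ∀ n, n ≠ 0 → l' n = l n := fun n hn => Function.update_of_ne hn _ _
  obtain ⟨D₁, hD₁, hc₁⟩ := exists_abs_sum_rpow_le_of_pos (l := l') (b := b)
    (fun n => by
      rcases eq_or_ne n 0 with rfl | h
      · simp [hl']
      · rw [hne n h]; exact hl n h)
    (by
      refine (summable_nat_add_iff 1).1 (((summable_nat_add_iff 1).2 hs).congr fun n => ?_)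
      rw [hne _ n.succ_ne_zero]) hb
  have hcont : ∀ (S : Finset ℕ) (a : ℕ → ℝ), Continuous fun x : ℝ => |∑ n ∈ S, a n * x ^ l n| := by
    intro S a
    refine (continuous_finsetSum _ fun n _ => continuous_const.mul ?_).abs
    refine continuous_id.rpow_const fun _ => Or.inr ?_
    rcases eq_or_ne n 0 with rfl | h
    exacts [hl0, (hl n h).le]
  have herase : ∀ (S : Finset ℕ) (a : ℕ → ℝ) (x : ℝ), 0 ∈ S →
      ∑ n ∈ S, a n * x ^ l n = a 0 + ∑ n ∈ S.erase 0, a n * x ^ l' n := by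
    intro S a x h
    rw [← Finset.add_sum_erase S _ h, ← h0, Real.rpow_zero, mul_one]
    congr 1
    exact Finset.sum_congr rfl fun n hn => by rw [hne n (Finset.ne_of_mem_erase hn)]
  refine ⟨D₀ + D₁ * (1 + D₀), by positivity, fun S a x hx0 hxb => ?_⟩
  set M := ∫ x in (0 : ℝ)..1, |∑ n ∈ S, a n * x ^ l n| with hM
  have hM0 : 0 ≤ M := intervalIntegral.integral_nonneg zero_le_one fun _ _ => abs_nonneg _
  by_cases h : 0 ∈ S
  · have h1 := hc S a h
    have h2 := hc₁ (S.erase 0) a x hx0 hxb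
    have h3 : ∫ x in (0 : ℝ)..1, |∑ n ∈ S.erase 0, a n * x ^ l' n| ≤ M + |a 0| := by
      have : ∫ x in (0 : ℝ)..1, (|∑ n ∈ S, a n * x ^ l n| + |a 0|) = M + |a 0| := by
        rw [intervalIntegral.integral_add ((hcont S a).intervalIntegrable _ _)
          intervalIntegrable_const]
        simp [hM]
      rw [← this]
      have hle : ∀ x : ℝ, |∑ n ∈ S.erase 0, a n * x ^ l' n| ≤ |∑ n ∈ S, a n * x ^ l n| + |a 0| := by
        intro x
        rw [eq_sub_of_add_eq' (herase S a x h).symm]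
        exact abs_sub _ _
      refine intervalIntegral.integral_mono_on zero_le_one ?_ ?_ fun x _ => hle x
      · have : (fun x : ℝ => |∑ n ∈ S.erase 0, a n * x ^ l' n|) =
            fun x : ℝ => |∑ n ∈ S.erase 0, a n * x ^ l n| := by
          funext x
          congr 1
          exact Finset.sum_congr rfl fun n hn => by rw [hne n (Finset.ne_of_mem_erase hn)]
        rw [this]
        exact (hcont _ a).intervalIntegrable _ _
      · exact ((hcont S a).add continuous_const).intervalIntegrable _ _
    rw [herase S a x h]
    calc _ ≤ |a 0| + |∑ n ∈ S.erase 0, a n * x ^ l' n| := abs_add_le _ _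
      _ ≤ D₀ * M + D₁ * (M + D₀ * M) :=
          add_le_add h1 (h2.trans (mul_le_mul_of_nonneg_left (h3.trans (by gcongr)) hD₁))
      _ = _ := by ring
  · have heq : ∀ x : ℝ, ∑ n ∈ S, a n * x ^ l' n = ∑ n ∈ S, a n * x ^ l n := fun x =>
      Finset.sum_congr rfl fun n hn => by rw [hne n (fun h' => h (h' ▸ hn))]
    have h2 := hc₁ S a x hx0 hxb
    simp_rw [heq] at h2
    refine h2.trans ?_
    gcongr
    nlinarith

theorem integral_unitInterval_eq {E : Type*} [NormedAddCommGroup E] [NormedSpace ℝ E] (f : ℝ → E) :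
    ∫ x : I, f x = ∫ x in (0 : ℝ)..1, f x := by
  rw [unitInterval.measurePreserving_coe.integral_comp unitInterval.measurableEmbedding_coe,
    intervalIntegral.integral_of_le zero_le_one, integral_Icc_eq_integral_Ioc]

variable {𝕜 : Type*} [RCLike 𝕜]

theorem mem_polySpace_iff {Λ : ℕ → ℝ≥0} {p : C(I, 𝕜)} :
    p ∈ polySpace 𝕜 Λ ↔ ∃ (S : Finset ℕ) (a : ℕ → 𝕜), p = ∑ n ∈ S, a n • monomial 𝕜 (Λ n) := by
  rw [polySpace, Finsupp.mem_span_range_iff_exists_finsupp]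
  constructor
  · rintro ⟨c, rfl⟩
    exact ⟨c.support, c, rfl⟩
  · rintro ⟨S, a, rfl⟩
    refine Finsupp.mem_span_range_iff_exists_finsupp.1 ?_
    exact Submodule.sum_mem _ fun n _ => Submodule.smul_mem _ _ (Submodule.subset_span ⟨n, rfl⟩)

theorem integrable_of_continuous {f : I → ℝ} (hf : Continuous f) : Integrable f := by
  exact hf.integrable_of_hasCompactSupport (HasCompactSupport.of_compactSpace f)

/-- Under the Müntz condition, the `L¹` norm controls the sup norm of Müntz polynomials on
`[0, b]` for every `b < 1`. -/
theorem exists_norm_le_integral_norm {Λ : ℕ → ℝ≥0} (hΛ : StrictMono Λ)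
    (hs : Summable fun n => 1 / (Λ n : ℝ)) {b : ℝ} (hb : b < 1) :
    ∃ D : ℝ, 0 ≤ D ∧ ∀ p ∈ polySpace 𝕜 Λ, ∀ x : I, (x : ℝ) ≤ b → ‖p x‖ ≤ D * ∫ y, ‖p y‖ := by
  obtain ⟨D, hD0, hD⟩ := exists_abs_sum_rpow_le (l := fun n => (Λ n : ℝ)) (Λ 0).coe_nonneg
    (fun n hn => NNReal.coe_pos.2 (zero_le.trans_lt (hΛ (Nat.pos_of_ne_zero hn)))) hs hb
  refine ⟨2 * D, by positivity, fun p hp x hx => ?_⟩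
  obtain ⟨S, a, rfl⟩ := mem_polySpace_iff.1 hp
  set p := ∑ n ∈ S, a n • monomial 𝕜 (Λ n) with hpdef
  have happ : ∀ y : I, p y = ∑ n ∈ S, a n * (((y : ℝ) ^ (Λ n : ℝ) : ℝ) : 𝕜) := by
    intro y
    rw [hpdef, ContinuousMap.sum_apply]
    rfl
  have hre : ∀ y : I, RCLike.re (p y) = ∑ n ∈ S, RCLike.re (a n) * (y : ℝ) ^ (Λ n : ℝ) := by
    intro y
    rw [happ, map_sum]
    exact Finset.sum_congr rfl fun n _ => by rw [RCLike.re_mul_ofReal]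
  have him : ∀ y : I, RCLike.im (p y) = ∑ n ∈ S, RCLike.im (a n) * (y : ℝ) ^ (Λ n : ℝ) := by
    intro y
    rw [happ, map_sum]
    exact Finset.sum_congr rfl fun n _ => by rw [RCLike.im_mul_ofReal]
  have hnorm : Integrable fun y => ‖p y‖ := integrable_of_continuous (by fun_prop)
  have h1 := hD S (fun n => RCLike.re (a n)) x x.2.1 hx
  have h2 := hD S (fun n => RCLike.im (a n)) x x.2.1 hx
  rw [← integral_unitInterval_eq (fun x : ℝ => |∑ n ∈ S, RCLike.re (a n) * x ^ (Λ n : ℝ)|)] at h1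
  rw [← integral_unitInterval_eq (fun x : ℝ => |∑ n ∈ S, RCLike.im (a n) * x ^ (Λ n : ℝ)|)] at h2
  simp_rw [← hre] at h1
  simp_rw [← him] at h2
  have h3 : ∫ y, |RCLike.re (p y)| ≤ ∫ y, ‖p y‖ :=
    integral_mono (integrable_of_continuous (by fun_prop)) hnorm fun y => RCLike.abs_re_le_norm _
  have h4 : ∫ y, |RCLike.im (p y)| ≤ ∫ y, ‖p y‖ :=
    integral_mono (integrable_of_continuous (by fun_prop)) hnorm fun y => RCLike.abs_im_le_norm _
  have h5 : ‖p x‖ ≤ |RCLike.re (p x)| + |RCLike.im (p x)| := by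
    refine abs_le_of_sq_le_sq' ?_ (by positivity) |>.2
    rw [RCLike.norm_sq_eq_def]
    nlinarith [abs_mul_abs_self (RCLike.re (p x)), abs_mul_abs_self (RCLike.im (p x)),
      mul_nonneg (abs_nonneg (RCLike.re (p x))) (abs_nonneg (RCLike.im (p x)))]
  calc _ ≤ _ := h5
    _ ≤ D * (∫ y, ‖p y‖) + D * (∫ y, ‖p y‖) :=
        add_le_add (h1.trans (mul_le_mul_of_nonneg_left h3 hD0))
          (h2.trans (mul_le_mul_of_nonneg_left h4 hD0))
    _ = _ := by ring

/-- The class in `L¹([0, 1])` of a continuous function. -/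
abbrev toL1 (p : C(I, 𝕜)) : Lp 𝕜 1 (volume : Measure I) :=
  ContinuousMap.toLp (E := 𝕜) 1 (volume : Measure I) 𝕜 p

theorem coeFn_toL1 (p : C(I, 𝕜)) : toL1 p =ᵐ[volume] p := ContinuousMap.coeFn_toLp _ _

theorem norm_toL1 (p : C(I, 𝕜)) : ‖toL1 p‖ = ∫ x, ‖p x‖ := by
  rw [L1.norm_eq_integral_norm]
  exact integral_congr_ae ((coeFn_toL1 p).fun_comp norm)

theorem toL1_mem_MOne {Λ : ℕ → ℝ≥0} {p : C(I, 𝕜)} (hp : p ∈ polySpace 𝕜 Λ) :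
    toL1 p ∈ MOne 𝕜 Λ :=
  Submodule.le_topologicalClosure _ (Submodule.mem_map_of_mem hp)

theorem isClosed_MOne {Λ : ℕ → ℝ≥0} : IsClosed (MOne 𝕜 Λ : Set (Lp 𝕜 1 (volume : Measure I))) :=
  Submodule.isClosed_topologicalClosure _

theorem isClosed_MInfty {Λ : ℕ → ℝ≥0} : IsClosed (MInfty 𝕜 Λ : Set C(I, 𝕜)) :=
  Submodule.isClosed_topologicalClosure _

theorem toL1_mem_MOne_of_mem_MInfty {Λ : ℕ → ℝ≥0} {p : C(I, 𝕜)} (hp : p ∈ MInfty 𝕜 Λ) :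
    toL1 p ∈ MOne 𝕜 Λ := by
  have h : MapsTo (toL1 (𝕜 := 𝕜)) (polySpace 𝕜 Λ) (MOne 𝕜 Λ) := fun q hq => toL1_mem_MOne hq
  have := h.closure (ContinuousLinearMap.continuous _)
  have h2 := this hp
  rwa [isClosed_MOne.closure_eq] at h2

theorem exists_seq_of_mem_MOne {Λ : ℕ → ℝ≥0} {f : Lp 𝕜 1 (volume : Measure I)}
    (hf : f ∈ MOne 𝕜 Λ) : ∃ p : ℕ → C(I, 𝕜), (∀ k, p k ∈ polySpace 𝕜 Λ) ∧
      Tendsto (fun k => toL1 (p k)) atTop (𝓝 f) := by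
  obtain ⟨q, hq, hlim⟩ := mem_closure_iff_seq_limit.1 hf
  choose p hp hpq using hq
  refine ⟨p, hp, ?_⟩
  convert hlim using 2 with k
  exact hpq k

/-- If `L¹` norms control sup norms on `[0, b]` for Müntz polynomials, then elements of the
`L¹` closure have versions with the same control. -/
theorem exists_isContVersion {Λ : ℕ → ℝ≥0} {D : ℝ → ℝ}
    (hD : ∀ b < 1, ∀ p ∈ polySpace 𝕜 Λ, ∀ x : I, (x : ℝ) ≤ b → ‖p x‖ ≤ D b * ∫ y, ‖p y‖)
    {f : Lp 𝕜 1 (volume : Measure I)} (hf : f ∈ MOne 𝕜 Λ) :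
    ∃ g : I → 𝕜, IsContVersion f g ∧ ∀ b < 1, ∀ x : I, (x : ℝ) ≤ b → ‖g x‖ ≤ D b * ‖f‖ := by
  obtain ⟨p, hp, hlim⟩ := exists_seq_of_mem_MOne hf
  have hsub : ∀ b < 1, ∀ x : I, (x : ℝ) ≤ b → ∀ k l,
      ‖p k x - p l x‖ ≤ D b * ‖toL1 (p k) - toL1 (p l)‖ := by
    intro b hb x hx k l
    have := hD b hb (p k - p l) (Submodule.sub_mem _ (hp k) (hp l)) x hx
    rw [← norm_toL1] at this
    simpa [toL1] using this
  have hcau : ∀ x : I, (x : ℝ) < 1 → ∃ y, Tendsto (fun k => p k x) atTop (𝓝 y) := by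
    intro x hx
    refine cauchySeq_tendsto_of_complete ?_
    rw [cauchySeq_iff_tendsto_dist_atTop_0]
    have h1 := (cauchySeq_iff_tendsto_dist_atTop_0.1 hlim.cauchySeq).const_mul (D x)
    rw [mul_zero] at h1
    refine squeeze_zero (fun _ => dist_nonneg) (fun n => ?_) h1
    rw [dist_eq_norm, dist_eq_norm]
    exact hsub x hx x le_rfl _ _
  choose! g hg using hcau
  have hunif : ∀ b < 1, ∀ x : I, (x : ℝ) ≤ b → ∀ k, ‖p k x - g x‖ ≤ D b * ‖toL1 (p k) - f‖ := by
    intro b hb x hx k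
    refine le_of_tendsto_of_tendsto ((tendsto_const_nhds.sub (hg x (hx.trans_lt hb))).norm)
      ((tendsto_const_nhds.sub hlim).norm.const_mul (D b)) (.of_forall fun l => ?_)
    exact hsub b hb x hx k l
  refine ⟨g, ⟨?_, ?_⟩, ?_⟩
  · intro x hx
    have hx' : (x : ℝ) < 1 := hx
    obtain ⟨b, hxb, hb⟩ := exists_between hx'
    have hU : {y : I | (y : ℝ) < b} ∈ 𝓝 x :=
      (isOpen_lt continuous_subtype_val continuous_const).mem_nhds hxb
    have hc : ContinuousOn g {y : I | (y : ℝ) < b} := by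
      refine TendstoUniformlyOn.continuousOn (F := fun k => ⇑(p k)) (p := atTop) ?_
        (.of_forall fun k => (p k).continuous.continuousOn)
      rw [Metric.tendstoUniformlyOn_iff]
      intro ε hε
      have h1 : Tendsto (fun k => D b * ‖toL1 (p k) - f‖) atTop (𝓝 0) := by
        simpa using (tendsto_iff_norm_sub_tendsto_zero.1 hlim).const_mul (D b)
      filter_upwards [h1.eventually_lt_const hε] with k hk y hy
      rw [dist_comm, dist_eq_norm]
      exact (hunif b hb y (le_of_lt hy) k).trans_lt hk
    exact (hc.continuousAt hU).continuousWithinAt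
  · obtain ⟨ns, hns, hae⟩ := (tendstoInMeasure_of_tendsto_Lp hlim).exists_seq_tendsto_ae
    have h1 : ∀ᵐ x : I, ∀ k, toL1 (p k) x = p k x := ae_all_iff.2 fun k => coeFn_toL1 (p k)
    have h2 : ∀ᵐ x : I, x ≠ 1 := by simp [ae_iff, measure_singleton]
    filter_upwards [hae, h1, h2] with x hx1 hx2 hx3
    simp_rw [hx2] at hx1
    exact tendsto_nhds_unique hx1 ((hg x (lt_of_le_of_ne x.2.2 fun h => hx3 (Subtype.ext h))).comp
      hns.tendsto_atTop)
  · intro b hb x hx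
    refine le_of_tendsto_of_tendsto (hg x (hx.trans_lt hb)).norm (hlim.norm.const_mul (D b))
      (.of_forall fun k => ?_)
    change ‖p k x‖ ≤ D b * ‖toL1 (p k)‖
    rw [norm_toL1]
    exact hD b hb (p k) (hp k) x hx

theorem IsContVersion.add {f f' : Lp 𝕜 1 (volume : Measure I)} {g g' : I → 𝕜}
    (h : IsContVersion f g) (h' : IsContVersion f' g') : IsContVersion (f + f') (g + g') :=
  ⟨h.1.add h'.1, (Lp.coeFn_add f f').trans (h.2.add h'.2)⟩

theorem IsContVersion.const_smul {f : Lp 𝕜 1 (volume : Measure I)} {g : I → 𝕜}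
    (h : IsContVersion f g) (c : 𝕜) : IsContVersion (c • f) (c • g) :=
  ⟨h.1.const_smul c, (Lp.coeFn_smul c f).trans (h.2.const_smul c)⟩

theorem isContVersion_toL1 (p : C(I, 𝕜)) : IsContVersion (toL1 p) p :=
  ⟨p.continuous.continuousOn, coeFn_toL1 p⟩

/-- Integration over a set, as a bounded functional on `L¹([0, 1])`. -/
def setIntegralL (𝕜 : Type*) [RCLike 𝕜] (A : Set I) : Lp 𝕜 1 (volume : Measure I) →L[𝕜] 𝕜 :=
  LinearMap.mkContinuous
    { toFun := fun f => ∫ t in A, f t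
      map_add' := fun f g => by
        rw [← integral_add (L1.integrable_coeFn f).restrict (L1.integrable_coeFn g).restrict]
        exact integral_congr_ae (ae_restrict_of_ae (Lp.coeFn_add f g))
      map_smul' := fun c f => by
        rw [RingHom.id_apply, ← integral_smul]
        exact integral_congr_ae (ae_restrict_of_ae (Lp.coeFn_smul c f)) } 1 fun f => by
    rw [one_mul, L1.norm_eq_integral_norm]
    refine (norm_integral_le_integral_norm _).trans ?_
    exact setIntegral_le_integral (L1.integrable_coeFn f).norm (.of_forall fun _ => norm_nonneg _)

theorem setIntegralL_apply (A : Set I) (f : Lp 𝕜 1 (volume : Measure I)) :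
    setIntegralL 𝕜 A f = ∫ t in A, f t := rfl

theorem norm_setIntegralL_apply_le (A : Set I) (f : Lp 𝕜 1 (volume : Measure I)) :
    ‖setIntegralL 𝕜 A f‖ ≤ ‖f‖ := by
  simpa using LinearMap.mkContinuous_norm_le _ zero_le_one _ |> (setIntegralL 𝕜 A).le_of_opNorm_le
    (x := f)

theorem cesaro_zero (f : Lp 𝕜 1 (volume : Measure I)) : cesaro f 0 = valueAtZero f := if_pos rfl

theorem cesaro_of_ne {x : I} (hx : x ≠ 0) (f : Lp 𝕜 1 (volume : Measure I)) :
    cesaro f x = (x : ℝ)⁻¹ • setIntegralL 𝕜 (Iic x) f := if_neg hx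

theorem coe_pos_of_ne_zero {x : I} (hx : x ≠ 0) : 0 < (x : ℝ) :=
  lt_of_le_of_ne x.2.1 fun h => hx (Subtype.ext h.symm)

theorem cesaro_add {f f' : Lp 𝕜 1 (volume : Measure I)} {g g' : I → 𝕜}
    (h : IsContVersion f g) (h' : IsContVersion f' g') (x : I) :
    cesaro (f + f') x = cesaro f x + cesaro f' x := by
  rcases eq_or_ne x 0 with rfl | hx
  · rw [cesaro_zero, cesaro_zero, cesaro_zero, h.valueAtZero_eq, h'.valueAtZero_eq,
      (h.add h').valueAtZero_eq]
    rfl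
  · rw [cesaro_of_ne hx, cesaro_of_ne hx, cesaro_of_ne hx, map_add, smul_add]

theorem cesaro_smul {f : Lp 𝕜 1 (volume : Measure I)} {g : I → 𝕜} (h : IsContVersion f g)
    (c : 𝕜) (x : I) : cesaro (c • f) x = c * cesaro f x := by
  rcases eq_or_ne x 0 with rfl | hx
  · rw [cesaro_zero, cesaro_zero, h.valueAtZero_eq, (h.const_smul c).valueAtZero_eq]
    rfl
  · rw [cesaro_of_ne hx, cesaro_of_ne hx, map_smul, smul_eq_mul, mul_smul_comm]

theorem norm_cesaro_le {f : Lp 𝕜 1 (volume : Measure I)} {g : I → 𝕜} (h : IsContVersion f g)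
    {K : ℝ} (hK : 0 ≤ K) (hg : ∀ x : I, (x : ℝ) ≤ 1 / 2 → ‖g x‖ ≤ K * ‖f‖) (x : I) :
    ‖cesaro f x‖ ≤ (K + 2) * ‖f‖ := by
  have hf0 := norm_nonneg f
  rcases eq_or_ne x 0 with rfl | hx
  · rw [cesaro_zero, h.valueAtZero_eq]
    exact (hg 0 (by simp)).trans (by nlinarith)
  have hx0 := coe_pos_of_ne_zero hx
  rw [cesaro_of_ne hx, norm_smul, Real.norm_of_nonneg (inv_nonneg.2 hx0.le), inv_mul_le_iff₀ hx0]
  rcases le_total (x : ℝ) (1 / 2) with hx2 | hx2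
  · have h1 : ‖∫ t in Iic x, f t‖ ≤ (K * ‖f‖) * (volume : Measure I).real (Iic x) := by
      refine norm_setIntegral_le_of_norm_le_const_ae' (measure_lt_top _ _) ?_
      filter_upwards [h.2] with t ht htx
      rw [ht]
      exact hg t (le_trans htx hx2)
    have h2 : (volume : Measure I).real (Iic x) = x := by
      rw [Measure.real, unitInterval.volume_Iic, ENNReal.toReal_ofReal hx0.le]
    rw [h2] at h1
    rw [setIntegralL_apply]
    nlinarith [mul_nonneg hf0 hx0.le]
  · refine (norm_setIntegralL_apply_le _ f).trans ?_
    nlinarith [mul_nonneg (mul_nonneg hK hf0) hx0.le, mul_nonneg hf0 (sub_nonneg.2 hx2)]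

theorem setIntegral_Iic_eq {E : Type*} [NormedAddCommGroup E] [NormedSpace ℝ E] (f : ℝ → E) (x : I) :
    ∫ t in Iic x, f t = ∫ t in (0 : ℝ)..x, f t := by
  have h : (Iic x : Set I) = Subtype.val ⁻¹' (Iic (x : ℝ)) := rfl
  rw [h, unitInterval.measurePreserving_coe.setIntegral_preimage_emb
    unitInterval.measurableEmbedding_coe, Measure.restrict_restrict measurableSet_Iic,
    intervalIntegral.integral_of_le x.2.1, ← integral_Icc_eq_integral_Ioc]
  congr 2
  ext t
  simp only [mem_inter_iff, mem_Iic, mem_Icc]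
  constructor
  · rintro ⟨h1, h2, h3⟩; exact ⟨h2, h1⟩
  · rintro ⟨h1, h2⟩; exact ⟨h2, h1, h2.trans x.2.2⟩

theorem cesaro_toL1_monomial (c : ℝ≥0) (x : I) :
    cesaro (toL1 (monomial 𝕜 c)) x = ((((c : ℝ) + 1)⁻¹ : ℝ) : 𝕜) * monomial 𝕜 c x := by
  have hc : (0 : ℝ) ≤ c := c.coe_nonneg
  rcases eq_or_ne x 0 with rfl | hx
  · rw [cesaro_zero, (isContVersion_toL1 _).valueAtZero_eq]
    simp only [monomial, ContinuousMap.coe_mk, Icc.coe_zero]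
    rcases hc.eq_or_lt with h | h
    · rw [← h]; simp
    · rw [Real.zero_rpow h.ne']; simp
  · have hx0 := coe_pos_of_ne_zero hx
    have h1 : ∫ t in Iic x, toL1 (monomial 𝕜 c) t = ∫ t in Iic x, monomial 𝕜 c t :=
      integral_congr_ae (ae_restrict_of_ae (coeFn_toL1 _))
    have h2 : ∫ t in Iic x, monomial 𝕜 c t = (((x : ℝ) ^ ((c : ℝ) + 1) / (c + 1) : ℝ) : 𝕜) := by
      simp only [monomial, ContinuousMap.coe_mk]
      rw [integral_ofReal, setIntegral_Iic_eq (fun t : ℝ => t ^ (c : ℝ)),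
        integral_rpow (Or.inl (by linarith)), Real.zero_rpow (by linarith), sub_zero]
    rw [cesaro_of_ne hx, setIntegralL_apply, h1, h2, RCLike.real_smul_eq_coe_mul,
      ← RCLike.ofReal_mul]
    simp only [monomial, ContinuousMap.coe_mk]
    rw [← RCLike.ofReal_mul, Real.rpow_add_one hx0.ne']
    congr 1
    field_simp

theorem exists_cesaro_eq_of_mem_polySpace {Λ : ℕ → ℝ≥0} {p : C(I, 𝕜)} (hp : p ∈ polySpace 𝕜 Λ) :
    ∃ q ∈ polySpace 𝕜 Λ, ∀ x, q x = cesaro (toL1 p) x := by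
  induction hp using Submodule.span_induction with
  | mem p hp =>
    obtain ⟨n, rfl⟩ := hp
    refine ⟨((((Λ n : ℝ) + 1)⁻¹ : ℝ) : 𝕜) • monomial 𝕜 (Λ n),
      Submodule.smul_mem _ _ (Submodule.subset_span ⟨n, rfl⟩), fun x => ?_⟩
    rw [cesaro_toL1_monomial]; rfl
  | zero =>
    refine ⟨0, Submodule.zero_mem _, fun x => ?_⟩
    have := cesaro_smul (isContVersion_toL1 (0 : C(I, 𝕜))) 0 x
    rw [zero_smul, zero_mul] at this
    rw [toL1, map_zero, this]; rfl
  | add p p' _ _ h h' =>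
    obtain ⟨q, hq, hqx⟩ := h
    obtain ⟨q', hq', hqx'⟩ := h'
    refine ⟨q + q', Submodule.add_mem _ hq hq', fun x => ?_⟩
    rw [toL1, map_add, cesaro_add (isContVersion_toL1 p) (isContVersion_toL1 p'), ← hqx, ← hqx']
    rfl
  | smul c p _ h =>
    obtain ⟨q, hq, hqx⟩ := h
    refine ⟨c • q, Submodule.smul_mem _ c hq, fun x => ?_⟩
    rw [toL1, map_smul, cesaro_smul (isContVersion_toL1 p), ← hqx]
    rfl

/-- Under the Müntz condition, `L¹` norms control sup norms of continuous versions
on `[0, b]`, `b < 1`. -/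
theorem exists_version_bound (𝕜 : Type*) [RCLike 𝕜] {Λ : ℕ → ℝ≥0} (hΛ : StrictMono Λ)
    (hs : Summable fun n => 1 / (Λ n : ℝ)) :
    ∃ D : ℝ → ℝ, (∀ b < 1, 0 ≤ D b) ∧ ∀ f ∈ MOne 𝕜 Λ, ∃ g : I → 𝕜, IsContVersion f g ∧
      ∀ b < 1, ∀ x : I, (x : ℝ) ≤ b → ‖g x‖ ≤ D b * ‖f‖ := by
  have h : ∀ b : ℝ, ∃ D : ℝ, b < 1 → 0 ≤ D ∧ ∀ p ∈ polySpace 𝕜 Λ, ∀ x : I, (x : ℝ) ≤ b →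
      ‖p x‖ ≤ D * ∫ y, ‖p y‖ := fun b => by
    by_cases hb : b < 1
    · obtain ⟨D, hD⟩ := exists_norm_le_integral_norm (𝕜 := 𝕜) hΛ hs hb
      exact ⟨D, fun _ => hD⟩
    · exact ⟨0, fun h => absurd h hb⟩
  choose D hD using h
  exact ⟨D, fun b hb => (hD b hb).1,
    fun f hf => exists_isContVersion (fun b hb => (hD b hb).2) hf⟩

theorem exists_cesaro_eq_of_mem_MOne {Λ : ℕ → ℝ≥0} {K : ℝ}
    (hv : ∀ f ∈ MOne 𝕜 Λ, ∃ g : I → 𝕜, IsContVersion f g)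
    (hK : ∀ f ∈ MOne 𝕜 Λ, ∀ x, ‖cesaro f x‖ ≤ K * ‖f‖)
    {f : Lp 𝕜 1 (volume : Measure I)} (hf : f ∈ MOne 𝕜 Λ) :
    ∃ q ∈ MInfty 𝕜 Λ, ∀ x, q x = cesaro f x := by
  obtain ⟨p, hp, hlim⟩ := exists_seq_of_mem_MOne hf
  choose q hq hqx using fun k => exists_cesaro_eq_of_mem_polySpace (hp k)
  have hdiff : ∀ f₁ ∈ MOne 𝕜 Λ, ∀ f₂ ∈ MOne 𝕜 Λ, ∀ x,
      ‖cesaro f₁ x - cesaro f₂ x‖ ≤ K * ‖f₁ - f₂‖ := by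
    intro f₁ h₁ f₂ h₂ x
    obtain ⟨g₁, hg₁⟩ := hv f₁ h₁
    obtain ⟨g₂, hg₂⟩ := hv f₂ h₂
    have := hK (f₁ - f₂) (Submodule.sub_mem _ h₁ h₂) x
    rwa [sub_eq_add_neg, ← neg_one_smul 𝕜 f₂, cesaro_add hg₁ (hg₂.const_smul _), cesaro_smul hg₂,
      neg_one_mul, neg_one_smul, ← sub_eq_add_neg, ← sub_eq_add_neg] at this
  have hmem := fun k => toL1_mem_MOne (hp k)
  have hcau : CauchySeq q := by
    rw [cauchySeq_iff_tendsto_dist_atTop_0]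
    have h1 := (cauchySeq_iff_tendsto_dist_atTop_0.1 hlim.cauchySeq).const_mul |K|
    rw [mul_zero] at h1
    refine squeeze_zero (fun _ => dist_nonneg) (fun n => ?_) h1
    refine (ContinuousMap.dist_le (by positivity)).2 fun x => ?_
    rw [dist_eq_norm, dist_eq_norm, hqx, hqx]
    exact (hdiff _ (hmem _) _ (hmem _) x).trans (by gcongr; exact le_abs_self K)
  obtain ⟨F, hF⟩ := cauchySeq_tendsto_of_complete hcau
  refine ⟨F, ?_, fun x => ?_⟩
  · exact mem_closure_of_tendsto hF (.of_forall hq)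
  · have h1 : Tendsto (fun k => q k x) atTop (𝓝 (F x)) :=
      ((continuous_eval_const x).tendsto F).comp hF
    have h2 : Tendsto (fun k => q k x) atTop (𝓝 (cesaro f x)) := by
      rw [tendsto_iff_norm_sub_tendsto_zero]
      have h3 := (tendsto_iff_norm_sub_tendsto_zero.1 hlim).const_mul K
      rw [mul_zero] at h3
      refine squeeze_zero (fun _ => norm_nonneg _) (fun k => ?_) h3
      rw [hqx]
      exact hdiff _ (hmem k) _ hf x
    exact tendsto_nhds_unique h1 h2

/-- The Cesàro operator from `M_Λ¹` to `M_Λ^∞`. -/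
theorem exists_cesaroOperator {Λ : ℕ → ℝ≥0} (hΛ : StrictMono Λ)
    (hs : Summable fun n => 1 / (Λ n : ℝ)) :
    ∃ Γ : MOne 𝕜 Λ →L[𝕜] MInfty 𝕜 Λ,
      ∀ (f : MOne 𝕜 Λ) (x : I), (Γ f : C(I, 𝕜)) x = cesaro f.1 x := by
  obtain ⟨D, hD0, hD⟩ := exists_version_bound 𝕜 hΛ hs
  have hhalf : (1 / 2 : ℝ) < 1 := by norm_num
  have hv : ∀ f ∈ MOne 𝕜 Λ, ∃ g : I → 𝕜, IsContVersion f g := fun f hf => by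
    obtain ⟨g, hg, -⟩ := hD f hf
    exact ⟨g, hg⟩
  have hK : ∀ f ∈ MOne 𝕜 Λ, ∀ x, ‖cesaro f x‖ ≤ (D (1 / 2) + 2) * ‖f‖ := fun f hf x => by
    obtain ⟨g, hg, hgb⟩ := hD f hf
    exact norm_cesaro_le hg (hD0 _ hhalf) (hgb _ hhalf) x
  choose q hq hqx using fun f : MOne 𝕜 Λ => exists_cesaro_eq_of_mem_MOne hv hK f.2
  let L : MOne 𝕜 Λ →ₗ[𝕜] MInfty 𝕜 Λ :=
    { toFun := fun f => ⟨q f, hq f⟩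
      map_add' := fun f f' => by
        obtain ⟨g, hg⟩ := hv f.1 f.2
        obtain ⟨g', hg'⟩ := hv f'.1 f'.2
        ext x
        change q (f + f') x = q f x + q f' x
        rw [hqx, hqx, hqx]
        exact cesaro_add hg hg' x
      map_smul' := fun c f => by
        obtain ⟨g, hg⟩ := hv f.1 f.2
        ext x
        change q (c • f) x = c * q f x
        rw [hqx, hqx]
        exact cesaro_smul hg c x }
  have hL : ∀ f, ‖L f‖ ≤ (D (1 / 2) + 2) * ‖f‖ := by
    refine fun f => (ContinuousMap.norm_le _ ?_).2 fun x => ?_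
    · exact mul_nonneg (by linarith [hD0 _ hhalf]) (norm_nonneg _)
    · change ‖q f x‖ ≤ _
      rw [hqx]
      exact hK f.1 f.2 x
  have hc : Continuous L := AddMonoidHomClass.continuous_of_bound L (D (1 / 2) + 2) hL
  refine ⟨⟨L, hc⟩, fun f x => ?_⟩
  change q f x = _
  exact hqx f x

section WeakTopology

variable {X : Type*} [NormedAddCommGroup X] [NormedSpace 𝕜 X]

theorem continuous_dual_weakSpace (φ : StrongDual 𝕜 X) :
    Continuous fun x : WeakSpace 𝕜 X => φ ((toWeakSpace 𝕜 X).symm x) :=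
  WeakBilin.eval_continuous (topDualPairing 𝕜 X).flip φ

theorem tendsto_toWeakSpace_zero_iff {u : ℕ → X} :
    Tendsto (fun n => toWeakSpace 𝕜 X (u n)) atTop (𝓝 0) ↔
      ∀ φ : StrongDual 𝕜 X, Tendsto (fun n => φ (u n)) atTop (𝓝 0) := by
  have hi : IsInducing fun (x : WeakSpace 𝕜 X) (φ : StrongDual 𝕜 X) =>
      φ ((toWeakSpace 𝕜 X).symm x) := ⟨rfl⟩
  rw [hi.tendsto_nhds_iff, tendsto_pi_nhds]
  refine forall_congr' fun φ => ?_
  rw [map_zero, map_zero]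
  rfl

theorem exists_norm_le_of_forall_tendsto_zero {u : ℕ → X}
    (hu : ∀ φ : StrongDual 𝕜 X, Tendsto (fun n => φ (u n)) atTop (𝓝 0)) : ∃ M, ∀ n, ‖u n‖ ≤ M := by
  obtain ⟨M, hM⟩ := banach_steinhaus (g := fun n => NormedSpace.inclusionInDoubleDual 𝕜 X (u n))
    fun φ => by
      obtain ⟨C, hC⟩ := (hu φ).norm.bddAbove_range
      exact ⟨C, fun n => hC ⟨n, rfl⟩⟩
  refine ⟨M, fun n => ?_⟩
  rw [← (NormedSpace.inclusionInDoubleDualLi 𝕜 (E := X)).norm_map]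
  exact hM n

/-- A sequence whose increments are weakly unconditionally summable is weakly Cauchy. -/
theorem exists_tendsto_dual_of_norm_sum_le {m : ℕ → X} {B : ℝ}
    (hB : ∀ c : ℕ → 𝕜, (∀ n, ‖c n‖ ≤ 1) → ∀ N,
      ‖∑ n ∈ Finset.range N, c n • (m n - m (n + 1))‖ ≤ B) (φ : StrongDual 𝕜 X) :
    ∃ L, Tendsto (fun n => φ (m n)) atTop (𝓝 L) := by
  refine cauchySeq_tendsto_of_complete (cauchySeq_of_summable_dist ?_)
  refine summable_of_sum_range_le (c := ‖φ‖ * B) (fun _ => dist_nonneg) fun N => ?_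
  choose c hc1 hc using fun n => RCLike.exists_norm_eq_mul_self (φ (m n - m (n + 1)))
  have h1 : ((∑ n ∈ Finset.range N, dist (φ (m n)) (φ (m n.succ)) : ℝ) : 𝕜) =
      φ (∑ n ∈ Finset.range N, c n • (m n - m (n + 1))) := by
    rw [map_sum, RCLike.ofReal_sum]
    refine Finset.sum_congr rfl fun n _ => ?_
    rw [map_smul, smul_eq_mul, ← hc, map_sub, dist_eq_norm]
  have h3 : (0 : ℝ) ≤ ∑ n ∈ Finset.range N, dist (φ (m n)) (φ (m n.succ)) :=
    Finset.sum_nonneg fun _ _ => dist_nonneg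
  have h4 := congrArg norm h1
  rw [RCLike.norm_ofReal, abs_of_nonneg h3] at h4
  rw [h4]
  exact (φ.le_opNorm _).trans
    (mul_le_mul_of_nonneg_left (hB c (fun n => (hc1 n).le) N) (norm_nonneg _))

theorem exists_rightInverse_of_bijective {Y : Type*} [NormedAddCommGroup Y] [NormedSpace 𝕜 Y]
    [CompleteSpace X] [CompleteSpace Y] {T : X →L[𝕜] Y} (hT : Function.Bijective T) :
    ∃ S : Y →L[𝕜] X, ∀ y, T (S y) = y :=
  ⟨(ContinuousLinearEquiv.ofBijective T (LinearMap.ker_eq_bot.2 hT.1)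
    (LinearMap.range_eq_top.2 hT.2)).symm, fun y =>
      (ContinuousLinearEquiv.ofBijective T (LinearMap.ker_eq_bot.2 hT.1)
        (LinearMap.range_eq_top.2 hT.2)).apply_symm_apply y⟩

theorem exists_norm_map_le {Y : Type*} [NormedAddCommGroup Y] [NormedSpace 𝕜 Y] (T : X →L[𝕜] Y) :
    ∃ K, 0 ≤ K ∧ ∀ x, ‖T x‖ ≤ K * ‖x‖ :=
  ⟨‖T‖, norm_nonneg _, T.le_opNorm⟩

end WeakTopology

theorem setIntegral_eq_zero_of_forall_Iic {f : I → 𝕜} (hf : Integrable f)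
    (h : ∀ x : I, x ≠ 0 → ∫ t in Iic x, f t = 0) {A : Set I} (hA : MeasurableSet A) :
    ∫ t in A, f t = 0 := by
  have h' : ∀ x : I, ∫ t in Iic x, f t = 0 := by
    intro x
    rcases eq_or_ne x 0 with rfl | hx
    · refine setIntegral_measure_zero _ ?_
      rw [unitInterval.volume_Iic]; simp
    · exact h x hx
  have huniv : ∫ t, f t = 0 := by
    have := h' 1
    rwa [show (Iic (1 : I)) = univ from eq_univ_of_forall fun x => unitInterval.le_one', setIntegral_univ]
      at this
  induction A, hA using MeasurableSpace.induction_on_inter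
    (BorelSpace.measurable_eq.trans (borel_eq_generateFrom_Iic I)) isPiSystem_Iic with
  | empty => simp
  | basic t ht =>
    obtain ⟨x, rfl⟩ := ht
    exact h' x
  | compl t ht ih =>
    have := integral_add_compl ht hf
    rwa [ih, zero_add, huniv] at this
  | iUnion s hd hm ih =>
    rw [integral_iUnion hm hd hf.integrableOn]
    simp [ih]

theorem tendsto_setIntegral_norm_Ioi {f : I → 𝕜} (hf : Integrable f) {x : I} (hx : x < 1) {ε : ℝ}
    (hε : 0 < ε) : ∃ b : I, x < b ∧ b < 1 ∧ ∫ t in Ioi b, ‖f t‖ < ε := by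
  obtain ⟨b, hmono, hmem, hlim⟩ := exists_seq_strictMono_tendsto' hx
  have h := tendsto_setIntegral_of_antitone (μ := (volume : Measure I)) (f := fun t => ‖f t‖)
    (s := fun n => Ioi (b n)) (fun _ => measurableSet_Ioi)
    (fun m n hmn => Ioi_subset_Ioi (hmono.monotone hmn)) ⟨0, hf.norm.integrableOn⟩
  have h0 : ∫ t in ⋂ n, Ioi (b n), ‖f t‖ = 0 := by
    refine setIntegral_measure_zero _ (measure_mono_null (t := {1}) ?_ (measure_singleton _))
    intro t ht
    have : (1 : I) ≤ t := le_of_tendsto' hlim fun n => (mem_iInter.1 ht n).le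
    exact le_antisymm unitInterval.le_one' this
  rw [h0] at h
  obtain ⟨n, hn⟩ := (h.eventually_lt_const hε).exists
  exact ⟨b n, (hmem n).1, (hmem n).2, hn⟩

theorem norm_setIntegral_Iic_le {f : I → 𝕜} (hf : Integrable f) {x a : I} (h : x ≤ a) :
    ‖∫ t in Iic x, f t‖ ≤ ∫ t in Iic a, ‖f t‖ :=
  (norm_integral_le_integral_norm _).trans
    (setIntegral_mono_set hf.norm.integrableOn (.of_forall fun _ => norm_nonneg _)
      (Iic_subset_Iic.2 h).eventuallyLE)

/-- Gliding hump: if the masses on `[0, a]`, `a < 1`, and the integrals over all measurable sets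
tend to zero, then the primitives tend to zero uniformly. -/
theorem eventually_norm_setIntegral_Iic_le {u : ℕ → I → 𝕜} (hu : ∀ n, Integrable (u n))
    (h1 : ∀ a : I, a < 1 → Tendsto (fun n => ∫ t in Iic a, ‖u n t‖) atTop (𝓝 0))
    (h2 : ∀ A : Set I, MeasurableSet A → Tendsto (fun n => ∫ t in A, u n t) atTop (𝓝 0))
    {ε : ℝ} (hε : 0 < ε) : ∀ᶠ n in atTop, ∀ x : I, ‖∫ t in Iic x, u n t‖ ≤ ε := by
  by_contra hcon
  have hfreq : ∃ᶠ n in atTop, ∃ x : I, ε < ‖∫ t in Iic x, u n t‖ := by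
    refine hcon.imp fun h => ?_
    simpa using h
  have hstep : ∀ s : ℕ × {a : I // a < 1}, ∃ n x, ∃ a' : {a : I // a < 1}, s.1 < n ∧
      s.2.1 < x ∧ x < a'.1 ∧ ∫ t in Iic s.2.1, ‖u n t‖ < ε / 4 ∧ ε < ‖∫ t in Iic x, u n t‖ ∧
      ∫ t in Ioi a'.1, ‖u n t‖ < ε / 4 := by
    rintro ⟨N, a, ha⟩
    have e1 := (h1 a ha).eventually_lt_const (show 0 < ε / 4 by positivity)
    have e2 := (tendsto_zero_iff_norm_tendsto_zero.1 (h2 (Iic 1) measurableSet_Iic)).eventually_lt_const hε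
    obtain ⟨n, ⟨x, hx⟩, hn1, hn2, hn3⟩ := (hfreq.and_eventually
      (e1.and (e2.and (eventually_gt_atTop N)))).exists
    have hx1 : x < 1 := by
      refine lt_of_le_of_ne unitInterval.le_one' ?_
      rintro rfl
      exact hx.not_gt hn2
    have hax : a < x := by
      by_contra! h
      have := norm_setIntegral_Iic_le (hu n) h
      linarith
    obtain ⟨b, hb1, hb2, hb3⟩ := tendsto_setIntegral_norm_Ioi (hu n) hx1 (show 0 < ε / 4 by positivity)
    exact ⟨n, x, ⟨b, hb2⟩, hn3, hax, hb1, hn1, hx, hb3⟩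
  choose n x a' hn hax hxa h3 h4 h5 using hstep
  let st : ℕ → ℕ × {a : I // a < 1} :=
    fun k => Nat.rec (0, ⟨0, zero_lt_one⟩) (fun _ s => (n s, a' s)) k
  have hst : ∀ k, st (k + 1) = (n (st k), a' (st k)) := fun k => rfl
  have hmono : Monotone fun k => ((st k).2 : I) := by
    refine monotone_nat_of_le_succ fun k => ?_
    rw [hst]
    exact ((hax _).trans (hxa _)).le
  have hnmono : StrictMono fun k => n (st k) := by
    refine strictMono_nat_of_lt_succ fun k => ?_
    have := hn (st (k + 1))
    rwa [hst] at this
  set A : Set I := ⋃ k, Ioc (st k).2.1 (x (st k)) with hA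
  have hAm : MeasurableSet A := MeasurableSet.iUnion fun _ => measurableSet_Ioc
  have hlow : ∀ k, ε / 4 ≤ ‖∫ t in A, u (n (st k)) t‖ := by
    intro k
    have hsub : Ioc (st k).2.1 (x (st k)) ⊆ A := subset_iUnion (fun k => Ioc (st k).2.1 (x (st k))) k
    have hdiff : A \ Ioc (st k).2.1 (x (st k)) ⊆ Iic (st k).2.1 ∪ Ioi (a' (st k)).1 := by
      rintro t ⟨htA, htk⟩
      obtain ⟨j, hj⟩ := mem_iUnion.1 htA
      rcases lt_trichotomy j k with hjk | rfl | hjk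
      · left
        refine (hj.2.trans (hxa _).le).trans ?_
        have := hmono (Nat.succ_le_of_lt hjk)
        simpa [hst] using this
      · exact absurd hj htk
      · right
        refine lt_of_le_of_lt ?_ hj.1
        have := hmono (Nat.succ_le_of_lt hjk)
        simpa [hst] using this
    set v := u (n (st k)) with hv
    have hvi : Integrable v := hu _
    have i1 : ∫ t in A, v t = (∫ t in A \ Ioc (st k).2.1 (x (st k)), v t) +
        ∫ t in Ioc (st k).2.1 (x (st k)), v t := by
      rw [← setIntegral_union disjoint_sdiff_left measurableSet_Ioc hvi.integrableOn
        hvi.integrableOn, sdiff_union_of_subset hsub]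
    have i2 : ∫ t in Iic (x (st k)), v t = (∫ t in Iic (st k).2.1, v t) +
        ∫ t in Ioc (st k).2.1 (x (st k)), v t := by
      rw [← setIntegral_union (Iic_disjoint_Ioc le_rfl) measurableSet_Ioc hvi.integrableOn
        hvi.integrableOn, Iic_union_Ioc_eq_Iic (hax _).le]
    have i3 : ‖∫ t in A \ Ioc (st k).2.1 (x (st k)), v t‖ ≤
        (∫ t in Iic (st k).2.1, ‖v t‖) + ∫ t in Ioi (a' (st k)).1, ‖v t‖ := by
      refine (norm_integral_le_integral_norm _).trans ?_
      rw [← setIntegral_union ?_ measurableSet_Ioi hvi.norm.integrableOn hvi.norm.integrableOn]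
      · exact setIntegral_mono_set hvi.norm.integrableOn (.of_forall fun _ => norm_nonneg _)
          hdiff.eventuallyLE
      · exact Iic_disjoint_Ioi ((hax _).trans (hxa _)).le
    have i4 : ‖∫ t in Iic (st k).2.1, v t‖ ≤ ∫ t in Iic (st k).2.1, ‖v t‖ :=
      norm_integral_le_integral_norm _
    have j1 := h3 (st k)
    have j2 := h4 (st k)
    have j3 := h5 (st k)
    rw [← hv] at j1 j2 j3
    rw [i1]
    rw [i2] at j2
    have k1 := norm_add_le (∫ t in Iic (st k).2.1, v t) (∫ t in Ioc (st k).2.1 (x (st k)), v t)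
    have k2 := norm_sub_norm_le (∫ t in Ioc (st k).2.1 (x (st k)), v t)
      (-∫ t in A \ Ioc (st k).2.1 (x (st k)), v t)
    rw [norm_neg, sub_neg_eq_add, add_comm] at k2
    rw [add_comm (∫ t in A \ Ioc (st k).2.1 (x (st k)), v t)] at *
    linarith
  have hlim := (tendsto_zero_iff_norm_tendsto_zero.1 (h2 A hAm)).comp hnmono.tendsto_atTop
  obtain ⟨k, hk⟩ := (hlim.eventually_lt_const (show 0 < ε / 4 by positivity)).exists
  exact (hlow k).not_gt hk

variable {Λ : ℕ → ℝ≥0}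

/-- The Cesàro operator is Dunford–Pettis. -/
theorem isDunfordPettis_of_forall_eq_cesaro (hΛ : StrictMono Λ)
    (hs : Summable fun n => 1 / (Λ n : ℝ)) {Γ : MOne 𝕜 Λ →L[𝕜] MInfty 𝕜 Λ}
    (hΓ : ∀ (f : MOne 𝕜 Λ) (x : I), (Γ f : C(I, 𝕜)) x = cesaro f.1 x) :
    IsDunfordPettis (𝕜 := 𝕜) (X := MOne 𝕜 Λ) (Y := MInfty 𝕜 Λ) Γ := by
  intro u hu
  rw [tendsto_toWeakSpace_zero_iff] at hu
  obtain ⟨M, hM⟩ := exists_norm_le_of_forall_tendsto_zero hu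
  obtain ⟨D, hD0, hD⟩ := exists_version_bound 𝕜 hΛ hs
  choose g hg hgb using fun f : MOne 𝕜 Λ => hD f.1 f.2
  have hM0 : 0 ≤ M := (norm_nonneg _).trans (hM 0)
  have hpt : ∀ x : I, x < 1 → Tendsto (fun n => g (u n) x) atTop (𝓝 0) := by
    intro x hx
    let L : MOne 𝕜 Λ →ₗ[𝕜] 𝕜 :=
      { toFun := fun f => g f x
        map_add' := fun f f' => (hg (f + f')).eqOn ((hg f).add (hg f')) hx
        map_smul' := fun c f => (hg (c • f)).eqOn ((hg f).const_smul c) hx }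
    have hL : Continuous L := AddMonoidHomClass.continuous_of_bound L (D x)
      fun f => hgb f x hx x le_rfl
    exact hu ⟨L, hL⟩
  have hint : ∀ A : Set I, Tendsto (fun n => ∫ t in A, (u n).1 t) atTop (𝓝 0) := fun A =>
    hu ((setIntegralL 𝕜 A).comp (MOne 𝕜 Λ).subtypeL)
  have hae : ∀ᵐ t : I, ∀ n, (u n).1 t = g (u n) t := ae_all_iff.2 fun n => (hg (u n)).2
  have hmass : ∀ a : I, a < 1 → Tendsto (fun n => ∫ t in Iic a, ‖(u n).1 t‖) atTop (𝓝 0) := by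
    intro a ha
    have := tendsto_integral_of_dominated_convergence (μ := volume.restrict (Iic a))
      (F := fun n t => ‖(u n).1 t‖) (f := fun _ => 0) (fun _ => D a * M)
      (fun n => (L1.integrable_coeFn (u n).1).norm.aestronglyMeasurable.restrict)
      (integrable_const _) ?_ ?_
    · simpa using this
    · intro n
      filter_upwards [ae_restrict_of_ae (hg (u n)).2, ae_restrict_mem measurableSet_Iic] with t ht hta
      rw [norm_norm, ht]
      exact (hgb (u n) a ha t hta).trans (mul_le_mul_of_nonneg_left (hM n) (hD0 _ ha))
    · filter_upwards [ae_restrict_of_ae hae, ae_restrict_mem measurableSet_Iic] with t ht hta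
      simp_rw [ht]
      simpa using (hpt t (lt_of_le_of_lt hta ha)).norm
  have hunif := fun ε (hε : (0 : ℝ) < ε) => eventually_norm_setIntegral_Iic_le
    (fun n => L1.integrable_coeFn (u n).1) hmass (fun A _ => hint A) hε
  have hvpt : ∀ x : I, x ≠ 0 → Tendsto (fun n => (Γ (u n) : C(I, 𝕜)) x) atTop (𝓝 0) := by
    intro x hx
    simp_rw [hΓ, cesaro_of_ne hx]
    have := (hint (Iic x)).const_smul (x : ℝ)⁻¹
    rw [smul_zero] at this
    exact this
  obtain ⟨K, hK0, hK⟩ := exists_norm_map_le (𝕜 := 𝕜) (X := MOne 𝕜 Λ) (Y := MInfty 𝕜 Λ) Γ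
  have hvL1 : Tendsto (fun n => ‖toL1 (Γ (u n) : C(I, 𝕜))‖) atTop (𝓝 0) := by
    simp_rw [norm_toL1]
    have := tendsto_integral_of_dominated_convergence (μ := (volume : Measure I))
      (F := fun n t => ‖(Γ (u n) : C(I, 𝕜)) t‖) (f := fun _ => 0) (fun _ => K * M)
      (fun n => (Γ (u n) : C(I, 𝕜)).continuous.norm.aestronglyMeasurable)
      (integrable_const _) ?_ ?_
    · simpa using this
    · refine fun n => .of_forall fun t => ?_
      rw [norm_norm]
      exact (ContinuousMap.norm_coe_le_norm (Γ (u n) : C(I, 𝕜)) t).trans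
        ((hK (u n)).trans (mul_le_mul_of_nonneg_left (hM n) hK0))
    · have h0 : ∀ᵐ t : I, t ≠ 0 := by simp [ae_iff, measure_singleton]
      filter_upwards [h0] with t ht
      simpa using (hvpt t ht).norm
  have hhalf : (1 / 2 : ℝ) < 1 := by norm_num
  have hsmall : ∀ n, ∀ x : I, (x : ℝ) ≤ 1 / 2 →
      ‖(Γ (u n) : C(I, 𝕜)) x‖ ≤ D (1 / 2) * ‖toL1 (Γ (u n) : C(I, 𝕜))‖ := by
    intro n x hx
    obtain ⟨h, hh, hhb⟩ := hD _ (toL1_mem_MOne_of_mem_MInfty (Γ (u n)).2)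
    rw [(isContVersion_toL1 (Γ (u n) : C(I, 𝕜))).eqOn hh
      (show x < 1 from lt_of_le_of_lt (α := ℝ) hx hhalf)]
    exact hhb _ hhalf x hx
  refine tendsto_subtype_rng.2 ?_
  change Tendsto (fun n => (Γ (u n) : C(I, 𝕜))) atTop (𝓝 0)
  rw [Metric.tendsto_nhds]
  intro ε hε
  have hD' := hvL1.const_mul (D (1 / 2))
  rw [mul_zero] at hD'
  filter_upwards [hunif (ε / 4) (by positivity), hD'.eventually_lt_const (half_pos hε)] with n h1 h2
  rw [dist_zero_right]
  refine lt_of_le_of_lt ((ContinuousMap.norm_le (Γ (u n) : C(I, 𝕜)) (half_pos hε).le).2 fun x => ?_)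
    (half_lt_self hε)
  rcases le_total (x : ℝ) (1 / 2) with hx | hx
  · exact (hsmall n x hx).trans h2.le
  · have hx0 : (0 : ℝ) < x := lt_of_lt_of_le (by norm_num) hx
    have hx0' : x ≠ 0 := fun h => by rw [h] at hx0; simp at hx0
    rw [hΓ, cesaro_of_ne hx0', norm_smul, Real.norm_of_nonneg (inv_nonneg.2 hx0.le),
      inv_mul_le_iff₀ hx0]
    refine (h1 x).trans ?_
    nlinarith

theorem injective_of_forall_eq_cesaro {Γ : MOne 𝕜 Λ →L[𝕜] MInfty 𝕜 Λ}
    (hΓ : ∀ (f : MOne 𝕜 Λ) (x : I), (Γ f : C(I, 𝕜)) x = cesaro f.1 x) :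
    Function.Injective Γ := by
  refine (injective_iff_map_eq_zero Γ).2 fun f hf => ?_
  have h1 : ∀ x : I, x ≠ 0 → ∫ t in Iic x, f.1 t = 0 := by
    intro x hx
    have h := hΓ f x
    rw [hf, cesaro_of_ne hx] at h
    have h2 : (x : ℝ)⁻¹ • setIntegralL 𝕜 (Iic x) f.1 = 0 := h.symm
    rcases smul_eq_zero.1 h2 with h3 | h3
    · exact absurd h3 (inv_ne_zero (coe_pos_of_ne_zero hx).ne')
    · exact h3
  have hi := L1.integrable_coeFn f.1
  have h2 : f.1 =ᵐ[volume] 0 := Integrable.ae_eq_zero_of_forall_setIntegral_eq_zero hi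
    fun A hA _ => setIntegral_eq_zero_of_forall_Iic hi h1 hA
  exact Subtype.ext (Lp.eq_zero_iff_ae_eq_zero.2 h2)

/-- The multiple `(Λ n + 1) x ^ Λ n` of the monomial, as an element of `M_Λ¹`. -/
def normalizedMonomial (𝕜 : Type*) [RCLike 𝕜] (Λ : ℕ → ℝ≥0) (n : ℕ) : MOne 𝕜 Λ :=
  ⟨(((Λ n : ℝ) + 1 : ℝ) : 𝕜) • toL1 (monomial 𝕜 (Λ n)),
    Submodule.smul_mem _ _ (toL1_mem_MOne (Submodule.subset_span ⟨n, rfl⟩))⟩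

theorem norm_normalizedMonomial (n : ℕ) : ‖normalizedMonomial 𝕜 Λ n‖ = 1 := by
  have hc : (0 : ℝ) ≤ Λ n := (Λ n).coe_nonneg
  have h1 : ‖normalizedMonomial 𝕜 Λ n‖ =
      ‖(((Λ n : ℝ) + 1 : ℝ) : 𝕜) • toL1 (monomial 𝕜 (Λ n))‖ := rfl
  have h2 : ∀ x : I, ‖monomial 𝕜 (Λ n) x‖ = (x : ℝ) ^ (Λ n : ℝ) := fun x => by
    simp only [monomial, ContinuousMap.coe_mk]
    rw [RCLike.norm_ofReal, abs_of_nonneg (Real.rpow_nonneg x.2.1 _)]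
  rw [h1, norm_smul, norm_toL1, RCLike.norm_ofReal, abs_of_nonneg (by positivity)]
  simp_rw [h2]
  rw [integral_unitInterval_eq (fun x : ℝ => x ^ (Λ n : ℝ)), integral_rpow (Or.inl (by linarith)),
    Real.one_rpow, Real.zero_rpow (by linarith)]
  field_simp
  simp

theorem coe_map_normalizedMonomial {Γ : MOne 𝕜 Λ →L[𝕜] MInfty 𝕜 Λ}
    (hΓ : ∀ (f : MOne 𝕜 Λ) (x : I), (Γ f : C(I, 𝕜)) x = cesaro f.1 x) (n : ℕ) :
    (Γ (normalizedMonomial 𝕜 Λ n) : C(I, 𝕜)) = monomial 𝕜 (Λ n) := by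
  ext x
  have hc : (0 : ℝ) ≤ Λ n := (Λ n).coe_nonneg
  rw [hΓ]
  refine (cesaro_smul (isContVersion_toL1 _) _ x).trans ?_
  rw [cesaro_toL1_monomial, ← mul_assoc, ← RCLike.ofReal_mul, mul_inv_cancel₀ (by positivity),
    RCLike.ofReal_one, one_mul]

theorem dense_range_of_forall_eq_cesaro {Γ : MOne 𝕜 Λ →L[𝕜] MInfty 𝕜 Λ}
    (hΓ : ∀ (f : MOne 𝕜 Λ) (x : I), (Γ f : C(I, 𝕜)) x = cesaro f.1 x) :
    Dense (range Γ) := by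
  have hsub : polySpace 𝕜 Λ ≤ (LinearMap.range Γ.toLinearMap).map (MInfty 𝕜 Λ).subtype := by
    rw [polySpace, Submodule.span_le]
    rintro _ ⟨n, rfl⟩
    exact ⟨Γ (normalizedMonomial 𝕜 Λ n), ⟨_, rfl⟩, coe_map_normalizedMonomial hΓ n⟩
  intro y
  rw [closure_subtype]
  refine closure_mono ?_ y.2
  intro p hp
  obtain ⟨q, ⟨f, hf⟩, hq⟩ := hsub hp
  exact ⟨q, ⟨f, hf⟩, hq⟩

theorem tendsto_exponents (hΛ : StrictMono Λ) (hs : Summable fun n => 1 / (Λ n : ℝ)) :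
    Tendsto (fun n => (Λ n : ℝ)) atTop atTop := by
  have h := hs.tendsto_atTop_zero
  have hpos : ∀ᶠ n in atTop, 1 / (Λ n : ℝ) ∈ Ioi (0 : ℝ) := by
    filter_upwards [eventually_gt_atTop 0] with n hn
    have : (0 : ℝ) < Λ n := NNReal.coe_pos.2 (zero_le.trans_lt (hΛ hn))
    exact one_div_pos.2 this
  have := (tendsto_nhdsWithin_iff.2 ⟨h, hpos⟩).inv_tendsto_nhdsGT_zero
  refine this.congr fun n => ?_
  simp

theorem not_isWeaklyCompact_of_forall_eq_cesaro (hΛ : StrictMono Λ)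
    (hs : Summable fun n => 1 / (Λ n : ℝ)) {Γ : MOne 𝕜 Λ →L[𝕜] MInfty 𝕜 Λ}
    (hΓ : ∀ (f : MOne 𝕜 Λ) (x : I), (Γ f : C(I, 𝕜)) x = cesaro f.1 x) :
    ¬ IsWeaklyCompact (𝕜 := 𝕜) (X := MOne 𝕜 Λ) (Y := MInfty 𝕜 Λ) Γ := by
  intro hK
  have hmem : ∀ n, toWeakSpace 𝕜 (MInfty 𝕜 Λ) (Γ (normalizedMonomial 𝕜 Λ n)) ∈
      closure (toWeakSpace 𝕜 (MInfty 𝕜 Λ) '' (Γ '' Metric.closedBall 0 1)) := fun n => by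
    refine subset_closure ⟨_, ⟨_, ?_, rfl⟩, rfl⟩
    rw [mem_closedBall_zero_iff, norm_normalizedMonomial]
  obtain ⟨w, -, hw⟩ := hK.exists_mapClusterPt (f := atTop)
    (u := fun n => toWeakSpace 𝕜 (MInfty 𝕜 Λ) (Γ (normalizedMonomial 𝕜 Λ n)))
    (by rw [le_principal_iff]; exact Filter.mem_map.2 (univ_mem' hmem))
  set y : MInfty 𝕜 Λ := (toWeakSpace 𝕜 (MInfty 𝕜 Λ)).symm w
  have hval : ∀ (x : I) (L : 𝕜), Tendsto (fun n => monomial 𝕜 (Λ n) x) atTop (𝓝 L) →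
      (y : C(I, 𝕜)) x = L := by
    intro x L hL
    have hc := continuous_dual_weakSpace (𝕜 := 𝕜) (X := MInfty 𝕜 Λ)
      ((ContinuousMap.evalCLM 𝕜 x).comp (MInfty 𝕜 Λ).subtypeL)
    have h1 := hw.continuousAt_comp hc.continuousAt
    have h2 : Tendsto ((fun z : WeakSpace 𝕜 (MInfty 𝕜 Λ) =>
        ((ContinuousMap.evalCLM 𝕜 x).comp (MInfty 𝕜 Λ).subtypeL)
          ((toWeakSpace 𝕜 (MInfty 𝕜 Λ)).symm z)) ∘
        fun n => toWeakSpace 𝕜 (MInfty 𝕜 Λ) (Γ (normalizedMonomial 𝕜 Λ n))) atTop (𝓝 L) := by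
      refine hL.congr fun n => ?_
      rw [← coe_map_normalizedMonomial hΓ n]
      rfl
    have : NeBot (𝓝 ((y : C(I, 𝕜)) x) ⊓ 𝓝 L) := NeBot.mono h1 (inf_le_inf_left _ h2)
    exact eq_of_nhds_neBot this
  have h1 : (y : C(I, 𝕜)) 1 = 1 := by
    refine hval 1 1 (tendsto_const_nhds.congr fun n => ?_)
    simp [monomial]
  have h0 : EqOn (y : C(I, 𝕜)) (0 : C(I, 𝕜)) (Iio 1) := by
    intro x hx
    refine hval x 0 ?_
    have hx1 : (x : ℝ) < 1 := hx
    have h2 : Tendsto (fun n => (x : ℝ) ^ (Λ n : ℝ)) atTop (𝓝 0) :=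
      (tendsto_rpow_atTop_of_base_lt_one _ (by linarith [x.2.1]) hx1).comp (tendsto_exponents hΛ hs)
    have h3 := (RCLike.continuous_ofReal (K := 𝕜)).tendsto 0 |>.comp h2
    rw [RCLike.ofReal_zero] at h3
    exact h3
  have h2 := h0.closure (y : C(I, 𝕜)).continuous (0 : C(I, 𝕜)).continuous
  have h3 : (1 : I) ∈ closure (Iio 1) := by
    rw [closure_Iio' ⟨0, zero_lt_one⟩]; exact mem_Iic.2 le_rfl
  have h4 := h2 h3
  rw [h1] at h4
  exact one_ne_zero h4

theorem norm_sum_mul_monomial_sub_le (hΛ : Monotone Λ) (c : ℕ → 𝕜) (hc : ∀ n, ‖c n‖ ≤ 1) (N : ℕ) :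
    ‖∑ n ∈ Finset.range N, c n • (monomial 𝕜 (Λ n) - monomial 𝕜 (Λ (n + 1)))‖ ≤ 1 := by
  refine (ContinuousMap.norm_le _ zero_le_one).2 fun x => ?_
  rw [ContinuousMap.sum_apply]
  have h : ∀ n, ‖(c n • (monomial 𝕜 (Λ n) - monomial 𝕜 (Λ (n + 1)))) x‖ ≤
      (x : ℝ) ^ (Λ n : ℝ) - (x : ℝ) ^ (Λ (n + 1) : ℝ) := by
    intro n
    have h1 : (x : ℝ) ^ (Λ (n + 1) : ℝ) ≤ (x : ℝ) ^ (Λ n : ℝ) :=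
      Real.rpow_le_rpow_of_exponent_ge' x.2.1 x.2.2 (Λ n).coe_nonneg
        (NNReal.coe_le_coe.2 (hΛ n.le_succ))
    have h2 : (c n • (monomial 𝕜 (Λ n) - monomial 𝕜 (Λ (n + 1)))) x =
        c n * (((x : ℝ) ^ (Λ n : ℝ) - (x : ℝ) ^ (Λ (n + 1) : ℝ) : ℝ) : 𝕜) := by
      rw [RCLike.ofReal_sub]; rfl
    rw [h2, norm_mul, RCLike.norm_ofReal, abs_of_nonneg (sub_nonneg.2 h1)]
    exact mul_le_of_le_one_left (sub_nonneg.2 h1) (hc n)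
  refine (norm_sum_le _ _).trans ((Finset.sum_le_sum fun n _ => h n).trans ?_)
  rw [Finset.sum_range_sub']
  have h1 : (x : ℝ) ^ (Λ 0 : ℝ) ≤ 1 := Real.rpow_le_one x.2.1 x.2.2 (Λ 0).coe_nonneg
  have h2 : 0 ≤ (x : ℝ) ^ (Λ N : ℝ) := Real.rpow_nonneg x.2.1 _
  linarith

/-- The monomials form a weakly Cauchy sequence in `M_Λ^∞`. -/
theorem exists_tendsto_dual_monomial (hΛ : Monotone Λ) {m : ℕ → MInfty 𝕜 Λ}
    (hm : ∀ n, (m n : C(I, 𝕜)) = monomial 𝕜 (Λ n)) (φ : StrongDual 𝕜 (MInfty 𝕜 Λ)) :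
    ∃ L, Tendsto (fun n => φ (m n)) atTop (𝓝 L) := by
  refine exists_tendsto_dual_of_norm_sum_le (𝕜 := 𝕜) (X := MInfty 𝕜 Λ) (B := 1) (fun c hc N => ?_) φ
  have := norm_sum_mul_monomial_sub_le (𝕜 := 𝕜) hΛ c hc N
  simp_rw [← hm] at this
  convert this
  rw [Submodule.coe_norm]
  simp

theorem quarter_le_norm_monomial_sub {a b : ℝ≥0} (ha : 0 < a) (hab : 2 * (a : ℝ) ≤ b) :
    1 / 4 ≤ ‖monomial 𝕜 a - monomial 𝕜 b‖ := by
  have ha' : (0 : ℝ) < a := NNReal.coe_pos.2 ha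
  have h2 : (0 : ℝ) < 2 := two_pos
  set x : ℝ := (1 / 2 : ℝ) ^ ((a : ℝ)⁻¹) with hx
  have hx0 : 0 ≤ x := Real.rpow_nonneg (by norm_num) _
  have hx1 : x ≤ 1 := Real.rpow_le_one (by norm_num) (by norm_num) (inv_nonneg.2 ha'.le)
  have e1 : x ^ (a : ℝ) = 1 / 2 := Real.rpow_inv_rpow (by norm_num) ha'.ne'
  have e2 : x ^ (b : ℝ) ≤ 1 / 4 := by
    calc x ^ (b : ℝ) ≤ x ^ (2 * (a : ℝ)) :=
          Real.rpow_le_rpow_of_exponent_ge' hx0 hx1 (by positivity) hab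
      _ = 1 / 4 := by
          rw [mul_comm, Real.rpow_mul hx0, e1]; norm_num
  refine le_trans ?_ (ContinuousMap.norm_coe_le_norm _ (⟨x, hx0, hx1⟩ : I))
  have e3 : (monomial 𝕜 a - monomial 𝕜 b) (⟨x, hx0, hx1⟩ : I) =
      ((x ^ (a : ℝ) - x ^ (b : ℝ) : ℝ) : 𝕜) := by
    rw [RCLike.ofReal_sub]; rfl
  rw [e3, RCLike.norm_ofReal, e1]
  exact le_trans (by linarith) (le_abs_self _)

theorem not_isClosed_range_of_forall_eq_cesaro (hΛ : StrictMono Λ)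
    (hs : Summable fun n => 1 / (Λ n : ℝ)) {Γ : MOne 𝕜 Λ →L[𝕜] MInfty 𝕜 Λ}
    (hΓ : ∀ (f : MOne 𝕜 Λ) (x : I), (Γ f : C(I, 𝕜)) x = cesaro f.1 x) :
    ¬ IsClosed (range Γ) := by
  intro hcl
  have hsurj : range Γ = univ := hcl.closure_eq.symm.trans
    (dense_range_of_forall_eq_cesaro hΓ).closure_eq
  have : CompleteSpace (MOne 𝕜 Λ) := isClosed_MOne.completeSpace_coe
  have : CompleteSpace (MInfty 𝕜 Λ) := isClosed_MInfty.completeSpace_coe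
  obtain ⟨S, hS⟩ := exists_rightInverse_of_bijective (𝕜 := 𝕜) (X := MOne 𝕜 Λ) (Y := MInfty 𝕜 Λ) (T := Γ)
    ⟨injective_of_forall_eq_cesaro hΓ, range_eq_univ.1 hsurj⟩
  have hk : ∀ n, ∃ k, n ≤ k ∧ 2 * (Λ n : ℝ) ≤ Λ k := fun n =>
    ((eventually_ge_atTop n).and ((tendsto_exponents hΛ hs).eventually_ge_atTop _)).exists
  choose k hnk hΛk using hk
  set m : ℕ → MInfty 𝕜 Λ := fun n => Γ (normalizedMonomial 𝕜 Λ n) with hm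
  have hmc : ∀ n, (m n : C(I, 𝕜)) = monomial 𝕜 (Λ n) := coe_map_normalizedMonomial hΓ
  have hweak : Tendsto (fun n => toWeakSpace 𝕜 (MOne 𝕜 Λ) (S (m n - m (k n)))) atTop (𝓝 0) := by
    rw [tendsto_toWeakSpace_zero_iff]
    intro ψ
    obtain ⟨L, hL⟩ := exists_tendsto_dual_monomial hΛ.monotone hmc
      (ψ.comp S)
    have h1 := hL.sub (hL.comp (tendsto_atTop_mono hnk tendsto_id))
    rw [sub_self] at h1
    refine h1.congr fun n => ?_
    rw [map_sub S, map_sub ψ]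
    rfl
  have hnorm := ((continuous_subtype_val.tendsto _).comp
    (isDunfordPettis_of_forall_eq_cesaro hΛ hs hΓ _ hweak)).norm
  simp only [Function.comp_def, hS, Submodule.coe_zero, norm_zero] at hnorm
  obtain ⟨n, hn1, hn2⟩ := ((hnorm.eventually_lt_const (show (0 : ℝ) < 1 / 4 by norm_num)).and
    (eventually_gt_atTop 0)).exists
  have h1 := quarter_le_norm_monomial_sub (𝕜 := 𝕜) (zero_le.trans_lt (hΛ hn2)) (hΛk n)
  rw [← hmc, ← hmc] at h1
  exact hn1.not_ge h1
end Muntz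

end

theorem proposition4p2 {𝕜 : Type*} [RCLike 𝕜] (Λ : ℕ → ℝ≥0) (hΛ : StrictMono Λ)
    (hMuntz : Summable fun n => 1 / (Λ n : ℝ)) :
    (∀ f ∈ Muntz.MOne 𝕜 Λ, ∃ g : I → 𝕜, Muntz.IsContVersion f g) ∧
    ∃ Γ : Muntz.MOne 𝕜 Λ →L[𝕜] Muntz.MInfty 𝕜 Λ,
      (∀ (f : Muntz.MOne 𝕜 Λ) (x : I), (Γ f : C(I, 𝕜)) x = Muntz.cesaro f.1 x) ∧
      Function.Injective Γ ∧
      Dense (Set.range Γ) ∧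
      ¬ IsClosed (Set.range Γ) ∧
      Muntz.IsDunfordPettis (𝕜 := 𝕜) (X := Muntz.MOne 𝕜 Λ) (Y := Muntz.MInfty 𝕜 Λ) Γ ∧
      ¬ Muntz.IsWeaklyCompact (𝕜 := 𝕜) (X := Muntz.MOne 𝕜 Λ) (Y := Muntz.MInfty 𝕜 Λ) Γ := by
  obtain ⟨D, -, hD⟩ := Muntz.exists_version_bound 𝕜 hΛ hMuntz
  obtain ⟨Γ, hΓ⟩ := Muntz.exists_cesaroOperator (𝕜 := 𝕜) hΛ hMuntz
  refine ⟨fun f hf => ?_, Γ, hΓ, Muntz.injective_of_forall_eq_cesaro hΓ,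
    Muntz.dense_range_of_forall_eq_cesaro hΓ,
    Muntz.not_isClosed_range_of_forall_eq_cesaro hΛ hMuntz hΓ,
    Muntz.isDunfordPettis_of_forall_eq_cesaro hΛ hMuntz hΓ,
    Muntz.not_isWeaklyCompact_of_forall_eq_cesaro hΛ hMuntz hΓ⟩
  obtain ⟨g, hg, -⟩ := hD f hf
  exact ⟨g, hg⟩
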